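/- Let $F$ be a distribution function on $\mathbb{R}$ with quantile function $Q(s)=\inf\{x : F(x)\ge s\}$, $s\in(0,1)$, and assume that for some $\gamma>0$ and some function $\ell$ slowly varying at $0$, $$Q(1-s)=s^{-\gamma}\,\ell(s),\qquad s\in(0,1).$$ Let $U,U_1,U_2,\dots$ be i.i.d. uniform$(0,1)$ random variables, and let $U_{1,n}\le U_{2,n}\le\dots\le U_{n,n}$ be the order statistics of $U_1,\dots,U_n$. For $v\in(0,1)$ put $Y(v)=\log\frac{Q(1-Uv)}{Q(1-v)}$, let $Y(0)=-\gamma\log U$, and for $p>0$ write $$m_p(v)=\mathbb{E}\,Y(v)^p,\qquad \sigma_p^2(v)=\mathbf{Var}\big(Y(v)^p\big),\qquad \sigma_p(v)=\sqrt{\sigma_p^2(v)}.$$ Let $1\le k_n\le n$ be integers and $p_n>0$ real numbers such that $k_n\to\infty$, $k_n/n\to0$ and $p_n\to\infty$ as $n\to\infty$, and let $$\alpha=\liminf_{n\to\infty}\frac{\log k_n}{p_n}\in[0,\infty].$$ (i) If $\alpha>1$, then $$\frac{1}{k_n\,m_{p_n}(U_{k_n+1,n})}\sum_{i=1}^{k_n}\left(\log\frac{Q(1-U_{i,n})}{Q(1-U_{k_n+1,n})}\right)^{p_n}\longrightarrow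 1\quad\text{in probability.}$$ (ii) If $\alpha>2$, then $$\frac{1}{\sqrt{k_n}\,\sigma_{p_n}(U_{k_n+1,n})}\sum_{i=1}^{k_n}\left[\left(\log\frac{Q(1-U_{i,n})}{Q(1-U_{k_n+1,n})}\right)^{p_n}-m_{p_n}(U_{k_n+1,n})\right]\longrightarrow N(0,1)\quad\text{in distribution.}$$ (Since $U_{k_n+1,n}\to0$ in probability, and $k_n+1\le n$ for large $n$, all quantities are well defined with probability tending to $1$.) -/

import Mathlib

open MeasureTheory ProbabilityTheory Filter Topology Set

namespace ExtremalNorms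

/-- The quantile function `Q(s) = inf {x : F(x) ≥ s}` of a distribution function `F`. -/
noncomputable def quantile (F : ℝ → ℝ) (s : ℝ) : ℝ :=
  sInf {x : ℝ | s ≤ F x}

/-- `ℓ` is slowly varying at `0`: it is measurable and positive on some interval `(0, δ)`, and
`ℓ(c s) / ℓ(s) → 1` as `s ↓ 0` for every `c > 0`. -/
def SlowlyVaryingAtZero (ℓ : ℝ → ℝ) : Prop :=
  (∃ δ : ℝ, 0 < δ ∧ Measurable ((Ioo (0 : ℝ) δ).domRestrict ℓ) ∧ ∀ s ∈ Ioo (0 : ℝ) δ, 0 < ℓ s) ∧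
    ∀ c : ℝ, 0 < c → Tendsto (fun s : ℝ => ℓ (c * s) / ℓ s) (𝓝[>] 0) (𝓝 1)

/-- The order statistic `x_{i,n}`, i.e. the `i`-th smallest (`1 ≤ i ≤ n`, counted with
multiplicity) of the first `n` terms `x 0, …, x (n - 1)` of the sequence `x`.
Indices outside `1 ≤ i ≤ n` get the junk value `0`. -/
noncomputable def orderStat (x : ℕ → ℝ) (n i : ℕ) : ℝ :=
  if h : 1 ≤ i ∧ i ≤ n then
    x (Tuple.sort (fun j : Fin n => x j) ⟨i - 1, by omega⟩)
  else 0

/-- The uniform distribution on `(0, 1)`. -/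
noncomputable def unif01 : Measure ℝ := volume.restrict (Ioo (0 : ℝ) 1)

/-- `Y(v) = log (Q(1 - u v) / Q(1 - v))` as a function of the uniform variable `u`, with
`Y(0) = -γ log u`. -/
noncomputable def Y (Q : ℝ → ℝ) (γ v u : ℝ) : ℝ :=
  if v = 0 then -γ * Real.log u else Real.log (Q (1 - u * v) / Q (1 - v))

/-- `m_p(v) = E Y(v)^p`. -/
noncomputable def m (Q : ℝ → ℝ) (γ p v : ℝ) : ℝ :=
  ∫ u, (Y Q γ v u) ^ p ∂unif01

/-- `σ_p(v)`, the standard deviation of `Y(v)^p`. -/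
noncomputable def σ (Q : ℝ → ℝ) (γ p v : ℝ) : ℝ :=
  Real.sqrt (variance (fun u => (Y Q γ v u) ^ p) unif01)

end ExtremalNorms

namespace ExtremalNorms

/-! Given `V = U_{k+1,n}`, the `k` smaller points behave like `k` independent uniform variables on
`(0, V)`, so each sum is conditionally a normalised sum of `k` independent copies of `Y(V)^p`. If
`φ_n(v)` is the characteristic function of one summand given `V = v`, that of the sum is `E
φ_n(V)^k` (`integral_prod_orderStat`). Since `V → 0` almost surely, dominated convergence reduces
both claims to `k (φ_n(v_n) - 1) → c` along every deterministic `v_n ↓ 0`, with `c = it` in (i) and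
`c = -t²/2` in (ii) (`tendsto_charFun_sum_orderStat`).

Taylor expansion leaves an error governed by `k^(1-r) m_{rq}(v) / m_q(v)^r`, with `q = p` in (i), `q
= 2p` in (ii) and `r` slightly above `1`. Potter bounds squeeze `Y(v)` between affine functions of
the exponential variable `-log U` with slopes near `γ`, so `m_q(v)` is `(γq/e)^q` up to a constant
and a factor `L^{±q}`, with `L > 1` as close to `1` as desired (`moment_bounds_Y`). Hence the moment
ratio is about `r^{rq}`, while `log k ≥ aq` gives `k^(1-r) ≤ e^{-(r-1)aq}`. The total rate `r log r
- (r-1)a ≤ (r-1)(r-a)` is negative for `1 < r < a` (`exists_tendsto_moment_ratio`); this is where `α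
> 1`, respectively `α > 2`, enters. -/

/-! ### Order statistics of a finite sample. -/

lemma orderStat_succ (x : ℕ → ℝ) {n k : ℕ} (hk : k < n) :
    orderStat x n (k + 1) = x (Tuple.sort (fun j : Fin n => x j) ⟨k, hk⟩) := by
  unfold orderStat
  rw [dif_pos ⟨by omega, by omega⟩]
  rfl

/-- Sorting only permutes the sample, so the count of points below a level is unchanged. Reducing
order statistics to counts gives both their measurability and access to the law of large numbers. -/
lemma orderStat_le_iff (x : ℕ → ℝ) {n k : ℕ} (hk : k < n) (c : ℝ) :
    orderStat x n (k + 1) ≤ c ↔ k < (Finset.univ.filter fun i : Fin n => x i ≤ c).card := by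
  rw [orderStat_succ x hk]
  have h := Tuple.lt_card_le_iff_apply_le_of_monotone (j := ⟨k, hk⟩) (a := c)
    (Tuple.monotone_sort (fun j : Fin n => x j))
  simp only [Function.comp_apply] at h
  rw [← h]
  have : (Finset.univ.filter fun i : Fin n => x i ≤ c).card =
      (Finset.univ.filter fun i : Fin n => x (Tuple.sort (fun j : Fin n => x j) i) ≤ c).card := by
    symm
    refine Finset.card_bij (fun i _ => Tuple.sort (fun j : Fin n => x j) i) ?_ ?_ ?_
    · intro a ha; simpa using ha
    · intro a _ b _ hab; exact (Tuple.sort (fun j : Fin n => x j)).injective hab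
    · intro b hb
      refine ⟨(Tuple.sort (fun j : Fin n => x j)).symm b, ?_, ?_⟩
      · simpa using hb
      · simp
  rw [this]

lemma measurable_orderStat (n i : ℕ) : Measurable (fun x : ℕ → ℝ => orderStat x n i) := by
  by_cases h : 1 ≤ i ∧ i ≤ n
  · obtain ⟨k, rfl⟩ : ∃ k, i = k + 1 := ⟨i - 1, by omega⟩
    refine measurable_of_Iic fun c => ?_
    have : (fun x : ℕ → ℝ => orderStat x n (k + 1)) ⁻¹' Iic c =
        (fun x : ℕ → ℝ => ∑ i : Fin n, (Iic c).indicator (fun _ => (1 : ℕ)) (x i)) ⁻¹' Ioi k := by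
      ext x
      simp only [mem_preimage, mem_Iic, mem_Ioi]
      rw [orderStat_le_iff x (by omega), Finset.card_filter]
      simp [Set.indicator_apply]
    rw [this]
    refine measurableSet_preimage ?_ measurableSet_Ioi
    refine Finset.measurable_fun_sum _ fun i _ => ?_
    exact (measurable_const.indicator measurableSet_Iic).comp (measurable_pi_apply _)
  · simp [orderStat, h]

lemma orderStat_mem (x : ℕ → ℝ) {n k : ℕ} (hk : k < n) :
    ∃ i, orderStat x n (k + 1) = x i := ⟨_, orderStat_succ x hk⟩

/-- Among distinct points, the order statistic of rank `k + 1` is the only sample point having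
exactly `k` sample points below it, and those are the order statistics of rank at most `k`. -/
lemma prod_orderStat_eq (x : ℕ → ℝ) {n k : ℕ} (hk : k < n)
    (hx : Function.Injective fun j : Fin n => x j) {M : Type*} [CommMonoid M] (h : ℝ → ℝ → M) :
    ∃ j : Fin n, orderStat x n (k + 1) = x j ∧
      (∀ j' : Fin n, (Finset.univ.filter fun i : Fin n => x i < x j').card = k ↔ j' = j) ∧
      ∏ i ∈ Finset.Icc 1 k, h (orderStat x n i) (orderStat x n (k + 1)) =
        ∏ i ∈ Finset.univ.filter (fun i : Fin n => x i < x j), h (x i) (x j) := by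
  set s := Tuple.sort (fun j : Fin n => x j) with hs
  have hmono : StrictMono (fun a : Fin n => x (s a)) :=
    (Tuple.monotone_sort (fun j : Fin n => x j)).strictMono_of_injective
      (hx.comp s.injective)
  have hfil : ∀ a : Fin n, (Finset.univ.filter fun i : Fin n => x i < x (s a)) =
      (Finset.Iio a).map s.toEmbedding := by
    intro a
    ext i
    simp only [Finset.mem_filter, Finset.mem_univ, true_and, Finset.mem_map_equiv, Finset.mem_Iio]
    rw [← hmono.lt_iff_lt]
    simp
  refine ⟨s ⟨k, hk⟩, orderStat_succ x hk, fun j' => ?_, ?_⟩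
  · obtain ⟨a, rfl⟩ := s.surjective j'
    rw [hfil, Finset.card_map, Fin.card_Iio, s.injective.eq_iff, Fin.ext_iff]
  · rw [hfil, Finset.prod_map, orderStat_succ x hk]
    refine Finset.prod_bij' (fun i hi => (⟨i - 1, by have := Finset.mem_Icc.1 hi; omega⟩ : Fin n))
      (fun a _ => (a : ℕ) + 1) ?_ ?_ ?_ ?_ ?_
    · intro i hi
      have := Finset.mem_Icc.1 hi
      simp only [Finset.mem_Iio, Fin.lt_def]
      omega
    · intro a ha
      simp only [Finset.mem_Iio, Fin.lt_def] at ha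
      simp only [Finset.mem_Icc]
      omega
    · intro i hi
      have := Finset.mem_Icc.1 hi
      simp only
      omega
    · intro a ha
      simp
    · intro i hi
      have hi' := Finset.mem_Icc.1 hi
      obtain ⟨j, rfl⟩ : ∃ j, i = j + 1 := ⟨i - 1, by omega⟩
      rw [orderStat_succ x (by omega)]
      rfl

/-! ### The uniform law and the expansion over the set of points below a level. -/

instance : IsProbabilityMeasure unif01 := ⟨by simp [unif01]⟩

instance : NullSingletonClass unif01 := by unfold unif01; infer_instance

lemma ae_unif01 : ∀ᵐ u ∂unif01, u ∈ Ioo (0 : ℝ) 1 := ae_restrict_mem measurableSet_Ioo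

/-- The prefactor `v` does not depend on `f`, so two functions with the same rescaled mean are
interchangeable below level `v`. -/
lemma integral_unif01_scale {v : ℝ} (hv : v ∈ Ioo (0 : ℝ) 1) (f : ℝ → ℂ) :
    ∫ u, (Iio v).indicator f u ∂unif01 = v * ∫ u, f (u * v) ∂unif01 := by
  have h1 : ∫ u, (Iio v).indicator f u ∂unif01 = ∫ u in (0 : ℝ)..v, f u := by
    rw [integral_indicator measurableSet_Iio, unif01, Measure.restrict_restrict measurableSet_Iio,
      intervalIntegral.integral_of_le hv.1.le, integral_Ioc_eq_integral_Ioo]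
    congr 2
    ext u
    simp only [mem_inter_iff, mem_Iio, mem_Ioo]
    constructor
    · rintro ⟨h, h', _⟩; exact ⟨h', h⟩
    · rintro ⟨h, h'⟩; exact ⟨h', h, h'.trans hv.2⟩
  have h2 : ∫ u, f (u * v) ∂unif01 = ∫ u in (0 : ℝ)..1, f (u * v) := by
    rw [unif01, intervalIntegral.integral_of_le zero_le_one, integral_Ioc_eq_integral_Ioo]
  rw [h1, h2, intervalIntegral.integral_comp_mul_right _ hv.1.ne']
  have : (v : ℂ) ≠ 0 := by exact_mod_cast hv.1.ne'
  simp [this]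

/-- The product of `h (z i) v` over the points `z i` below `v`, restricted to the event that there
are exactly `k` of them. -/
noncomputable def rankProd {N : ℕ} (h : ℝ → ℝ → ℂ) (k : ℕ) (v : ℝ) (z : Fin N → ℝ) : ℂ :=
  if (Finset.univ.filter fun i => z i < v).card = k then
    ∏ i ∈ Finset.univ.filter (fun i => z i < v), h (z i) v else 0

/-- The factors in the expansion of `rankProd` over the set `S` of points below `v`. -/
noncomputable def rankFactor {N : ℕ} (h : ℝ → ℝ → ℂ) (v : ℝ) (S : Finset (Fin N)) (i : Fin N)
    (u : ℝ) : ℂ :=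
  if i ∈ S then (Iio v).indicator (fun u => h u v) u else (Ici v).indicator (fun _ => 1) u

/-- Only the term where `S` is the actual set of points below `v` survives. Each term is a product
over coordinates, so it factorises under the product measure. -/
lemma rankProd_eq_sum {N : ℕ} (h : ℝ → ℝ → ℂ) (k : ℕ) (v : ℝ) (z : Fin N → ℝ) :
    rankProd h k v z =
      ∑ S ∈ Finset.powersetCard k Finset.univ, ∏ i, rankFactor h v S i (z i) := by
  set T := Finset.univ.filter fun i => z i < v with hT
  have hterm : ∀ S : Finset (Fin N), ∏ i, rankFactor h v S i (z i) =
      if T = S then ∏ i ∈ T, h (z i) v else 0 := by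
    intro S
    split_ifs with hS
    · subst hS
      rw [hT, Finset.prod_filter]
      refine Finset.prod_congr rfl fun i _ => ?_
      by_cases hi : z i < v
      · simp [rankFactor, hi]
      · simp [rankFactor, hi, not_lt.1 hi]
    · have : ∃ i, ¬(i ∈ T ↔ i ∈ S) := by
        by_contra! hc
        exact hS (Finset.ext hc)
      obtain ⟨i, hi⟩ := this
      refine Finset.prod_eq_zero (Finset.mem_univ i) ?_
      have hiT : i ∈ T ↔ z i < v := by simp [hT]
      rw [hiT] at hi
      by_cases hS' : i ∈ S
      · have : ¬ z i < v := fun hh => hi ⟨fun _ => hS', fun _ => hh⟩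
        simp [rankFactor, hS', this]
      · have : z i < v := by
          by_contra hh
          exact hi ⟨fun h' => absurd h' hh, fun h' => absurd h' hS'⟩
        simp [rankFactor, hS', this]
  simp_rw [hterm]
  rw [Finset.sum_ite_eq]
  simp [rankProd, Finset.mem_powersetCard, hT]

lemma measurable_rankFactor {N : ℕ} {h : ℝ → ℝ → ℂ} (hm : Measurable (Function.uncurry h))
    (S : Finset (Fin N)) (i : Fin N) :
    Measurable fun q : ℝ × ℝ => rankFactor h q.1 S i q.2 := by
  unfold rankFactor
  split_ifs
  · have : (fun q : ℝ × ℝ => (Iio q.1).indicator (fun u => h u q.1) q.2) =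
        {q : ℝ × ℝ | q.2 < q.1}.indicator (fun q => h q.2 q.1) := by
      ext q; simp [Set.indicator_apply]
    rw [this]
    exact (hm.comp measurable_swap).indicator (measurableSet_lt measurable_snd measurable_fst)
  · have : (fun q : ℝ × ℝ => (Ici q.1).indicator (fun _ => (1 : ℂ)) q.2) =
        {q : ℝ × ℝ | q.1 ≤ q.2}.indicator (fun q => 1) := by
      ext q; simp [Set.indicator_apply]
    rw [this]
    exact measurable_const.indicator (measurableSet_le measurable_fst measurable_snd)

lemma norm_rankFactor_le {N : ℕ} {h : ℝ → ℝ → ℂ} (hb : ∀ u v, ‖h u v‖ ≤ 1) (v : ℝ)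
    (S : Finset (Fin N)) (i : Fin N) (u : ℝ) : ‖rankFactor h v S i u‖ ≤ 1 := by
  unfold rankFactor
  simp only [Set.indicator_apply]
  split_ifs <;> simp [hb]

lemma measurable_rankProd {N : ℕ} {h : ℝ → ℝ → ℂ} (hm : Measurable (Function.uncurry h)) (k : ℕ) :
    Measurable fun q : ℝ × (Fin N → ℝ) => rankProd h k q.1 q.2 := by
  simp_rw [rankProd_eq_sum]
  refine Finset.measurable_fun_sum _ fun S _ => Finset.measurable_fun_prod _ fun i _ => ?_
  exact (measurable_rankFactor hm S i).comp (g := fun q : ℝ × ℝ => rankFactor h q.1 S i q.2)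
    (f := fun q : ℝ × (Fin N → ℝ) => (q.1, q.2 i)) (by fun_prop)

lemma norm_rankProd_le {N : ℕ} {h : ℝ → ℝ → ℂ} (hb : ∀ u v, ‖h u v‖ ≤ 1) (k : ℕ) (v : ℝ)
    (z : Fin N → ℝ) : ‖rankProd h k v z‖ ≤ 1 := by
  unfold rankProd
  split_ifs
  · rw [norm_prod]
    exact Finset.prod_le_one (fun _ _ => norm_nonneg _) fun _ _ => hb _ _
  · simp

lemma integral_rankProd {N : ℕ} {h : ℝ → ℝ → ℂ} (hm : Measurable (Function.uncurry h))
    (hb : ∀ u v, ‖h u v‖ ≤ 1) (k : ℕ) (v : ℝ) :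
    ∫ z : Fin N → ℝ, rankProd h k v z ∂(Measure.pi fun _ => unif01) =
      ∑ S ∈ Finset.powersetCard k (Finset.univ : Finset (Fin N)), ∏ i : Fin N,
        (if i ∈ S then ∫ u, (Iio v).indicator (fun u => h u v) u ∂unif01
          else ∫ u, (Ici v).indicator (fun _ => (1 : ℂ)) u ∂unif01) := by
  simp_rw [rankProd_eq_sum]
  rw [integral_finsetSum]
  · refine Finset.sum_congr rfl fun S _ => ?_
    rw [integral_fintype_prod_eq_prod (fun i => rankFactor h v S i)]
    refine Finset.prod_congr rfl fun i _ => ?_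
    unfold rankFactor
    split_ifs <;> rfl
  · intro S _
    refine Integrable.fintype_prod fun i => ?_
    refine Integrable.of_bound (C := 1) ?_ (ae_of_all _ fun u => norm_rankFactor_le hb v S i u)
    exact ((measurable_rankFactor hm S i).comp measurable_prodMk_left).aestronglyMeasurable

/-! ### Conditioning an independent uniform sample on one order statistic. -/

section Sample

variable {Ω : Type*} [MeasurableSpace Ω] {P : Measure Ω}
  {U : ℕ → Ω → ℝ}

lemma map_sample_eq_pi [IsProbabilityMeasure P]
    (hU : ∀ i, HasLaw (U i) unif01 P) (hindep : iIndepFun U P) (n : ℕ) :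
    P.map (fun ω (j : Fin n) => U j ω) = Measure.pi fun _ => unif01 := by
  have h := (iIndepFun.precomp (g := fun j : Fin n => (j : ℕ)) Fin.val_injective hindep)
  have := iIndepFun.map_fun_eq_pi_map (fun i : Fin n => (hU i).aemeasurable) h
  rw [this]
  congr 1
  ext1 i
  exact (hU i).map_eq

lemma aemeasurable_sample (hU : ∀ i, HasLaw (U i) unif01 P) (n : ℕ) :
    AEMeasurable (fun ω (j : Fin n) => U j ω) P :=
  aemeasurable_pi_lambda _ fun i => (hU i).aemeasurable

lemma ae_mem_Ioo (hU : ∀ i, HasLaw (U i) unif01 P) : ∀ᵐ ω ∂P, ∀ i, U i ω ∈ Ioo (0 : ℝ) 1 := by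
  rw [ae_all_iff]
  intro i
  have h := ae_unif01
  rw [← (hU i).map_eq] at h
  exact ae_of_ae_map (hU i).aemeasurable h

lemma ae_injective [IsProbabilityMeasure P]
    (hU : ∀ i, HasLaw (U i) unif01 P) (hindep : iIndepFun U P) :
    ∀ᵐ ω ∂P, Function.Injective fun i => U i ω := by
  have : ∀ᵐ ω ∂P, ∀ i j, i ≠ j → U i ω ≠ U j ω := by
    rw [ae_all_iff]; intro i
    rw [ae_all_iff]; intro j
    by_cases hij : i = j
    · simp [hij]
    have h := (indepFun_iff_map_prod_eq_prod_map_map (hU i).aemeasurable (hU j).aemeasurable).1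
      (hindep.indepFun hij)
    rw [(hU i).map_eq, (hU j).map_eq] at h
    have h2 : ∀ᵐ q ∂(unif01.prod unif01), q.1 ≠ q.2 := by
      have hms : MeasurableSet {q : ℝ × ℝ | q.1 ≠ q.2} :=
        (measurableSet_eq_fun measurable_fst measurable_snd).compl
      rw [Measure.ae_prod_iff_ae_ae hms]
      refine ae_of_all _ fun x => ?_
      have : ∀ᵐ y ∂unif01, y ≠ x := by
        rw [ae_iff]; simp
      filter_upwards [this] with y hy using hy.symm
    rw [← h] at h2
    have := ae_of_ae_map ((hU i).aemeasurable.prodMk (hU j).aemeasurable) h2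
    filter_upwards [this] with ω hω _ using hω
  filter_upwards [this] with ω hω i j hij
  by_contra hne
  exact hω i j hne hij

/-- Almost surely there are no ties, so exactly one index carries rank `k + 1`. Summing over that
index and splitting off its coordinate leaves `N` points independent of it. -/
lemma integral_prod_orderStat_eq_sum [IsProbabilityMeasure P]
    (hU : ∀ i, HasLaw (U i) unif01 P) (hindep : iIndepFun U P)
    {N k : ℕ} (hk : k < N + 1) {h : ℝ → ℝ → ℂ} (hm : Measurable (Function.uncurry h))
    (hb : ∀ u v, ‖h u v‖ ≤ 1) :
    ∫ ω, ∏ i ∈ Finset.Icc 1 k, h (orderStat (fun j => U j ω) (N + 1) i)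
        (orderStat (fun j => U j ω) (N + 1) (k + 1)) ∂P =
      ∑ _j : Fin (N + 1), ∫ v, ∫ z : Fin N → ℝ, rankProd h k v z
        ∂(Measure.pi fun _ => unif01) ∂unif01 := by
  have hmj : ∀ j : Fin (N + 1), Measurable fun y : Fin (N + 1) → ℝ =>
      rankProd h k (y j) (fun i => y (j.succAbove i)) := fun j =>
    (measurable_rankProd hm k).comp
      (f := fun y : Fin (N + 1) → ℝ => (y j, fun i => y (j.succAbove i))) (by fun_prop)
  have h1 : ∀ᵐ ω ∂P, ∏ i ∈ Finset.Icc 1 k, h (orderStat (fun j => U j ω) (N + 1) i)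
        (orderStat (fun j => U j ω) (N + 1) (k + 1)) =
      ∑ j : Fin (N + 1), rankProd h k (U j ω) (fun i => U (j.succAbove i) ω) := by
    filter_upwards [ae_injective hU hindep] with ω hω
    obtain ⟨j, -, hj2, hj3⟩ := prod_orderStat_eq (fun j => U j ω) hk
      (hω.comp Fin.val_injective) h
    have hfil : ∀ j' : Fin (N + 1), (Finset.univ.filter fun i : Fin (N + 1) => U i ω < U j' ω) =
        (Finset.univ.filter fun i : Fin N => U (j'.succAbove i) ω < U j' ω).map
          j'.succAboveEmb := by
      intro j'
      ext i
      simp only [Finset.mem_filter, Finset.mem_univ, true_and, Finset.mem_map,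
        Fin.coe_succAboveEmb]
      constructor
      · intro hi
        obtain ⟨a, rfl⟩ := Fin.exists_succAbove_eq (x := i) (y := j')
          (by rintro rfl; exact lt_irrefl _ hi)
        exact ⟨a, hi, rfl⟩
      · rintro ⟨a, ha, rfl⟩; exact ha
    rw [Finset.sum_eq_single j, hj3]
    · have := (hj2 j).2 rfl
      rw [hfil, Finset.card_map] at this
      rw [hfil, Finset.prod_map, rankProd, if_pos this]
      rfl
    · intro j' _ hne
      have := mt (hj2 j').1 hne
      rw [hfil, Finset.card_map] at this
      rw [rankProd, if_neg this]
    · simp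
  rw [integral_congr_ae h1, integral_finsetSum]
  · refine Finset.sum_congr rfl fun j _ => ?_
    have h2 := integral_map (aemeasurable_sample hU (N + 1)) (hmj j).aestronglyMeasurable
    rw [map_sample_eq_pi hU hindep] at h2
    rw [← h2]
    have h3 := (measurePreserving_piFinSuccAbove (fun _ : Fin (N + 1) => unif01) j).integral_comp'
      (g := fun q : ℝ × (Fin N → ℝ) => rankProd h k q.1 q.2)
    have h4 := integral_prod (μ := unif01) (ν := Measure.pi fun _ : Fin N => unif01)
      (fun q : ℝ × (Fin N → ℝ) => rankProd h k q.1 q.2)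
      (Integrable.of_bound (C := 1) (measurable_rankProd hm k).aestronglyMeasurable
        (ae_of_all _ fun q => norm_rankProd_le hb k _ _))
    rw [← h4, ← h3]
    rfl
  · intro j _
    refine Integrable.of_bound (C := 1) ?_ (ae_of_all _ fun ω => norm_rankProd_le hb k _ _)
    exact ((hmj j).comp_aemeasurable (aemeasurable_sample hU (N + 1))).aestronglyMeasurable

/-- Conditionally on the order statistic `v` of rank `k + 1`, the smaller order statistics are
those of `k` independent uniform variables on `(0, v)`. -/
theorem integral_prod_orderStat [IsProbabilityMeasure P]
    (hU : ∀ i, HasLaw (U i) unif01 P) (hindep : iIndepFun U P)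
    {n k : ℕ} (hk : k < n) {h : ℝ → ℝ → ℂ} (hm : Measurable (Function.uncurry h))
    (hb : ∀ u v, ‖h u v‖ ≤ 1) :
    ∫ ω, ∏ i ∈ Finset.Icc 1 k, h (orderStat (fun j => U j ω) n i)
        (orderStat (fun j => U j ω) n (k + 1)) ∂P =
      ∫ ω, (∫ u, h (u * orderStat (fun j => U j ω) n (k + 1))
        (orderStat (fun j => U j ω) n (k + 1)) ∂unif01) ^ k ∂P := by
  obtain ⟨N, rfl⟩ : ∃ N, n = N + 1 := ⟨n - 1, by omega⟩
  set H : ℝ → ℂ := fun v => ∫ u, h (u * v) v ∂unif01 with hH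
  have hHm : Measurable H := by
    have : StronglyMeasurable fun q : ℝ × ℝ => h (q.2 * q.1) q.1 :=
      (hm.comp (f := fun q : ℝ × ℝ => (q.2 * q.1, q.1)) (by fun_prop)).stronglyMeasurable
    exact this.integral_prod_right.measurable
  have hHb : ∀ v, ‖H v‖ ≤ 1 := fun v => by
    have := norm_integral_le_of_norm_le_const (μ := unif01) (C := 1)
      (ae_of_all _ fun u => hb (u * v) v)
    simpa using this
  rw [integral_prod_orderStat_eq_sum hU hindep hk hm hb]
  -- The same expansion for the function `H v`, which ignores its first argument, produces `H ^ k`.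
  -- Both expansions agree termwise because `h` and `H` have the same mean over a uniform point of
  -- `(0, v)`.
  have h2 := integral_prod_orderStat_eq_sum hU hindep hk (h := fun _ v => H v)
    (hHm.comp measurable_snd) (fun _ v => hHb v)
  simp only [Finset.prod_const, Nat.card_Icc, Nat.add_sub_cancel] at h2
  rw [h2]
  refine Finset.sum_congr rfl fun j _ => ?_
  refine integral_congr_ae ?_
  filter_upwards [ae_unif01] with v hv
  rw [integral_rankProd hm hb, integral_rankProd (h := fun _ v => H v)
    (hHm.comp measurable_snd) (fun _ v => hHb v)]
  rw [integral_unif01_scale hv, integral_unif01_scale hv]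
  simp [hH]

end Sample

/-! ### Monotonicity and measurability of the quantile function. -/

section Quantile

variable (μ : Measure ℝ)

lemma quantile_set_nonempty {s : ℝ} (hs : s < 1) : {x : ℝ | s ≤ cdf μ x}.Nonempty :=
  ((tendsto_cdf_atTop μ).eventually_const_le hs).exists

lemma quantile_set_bddBelow {s : ℝ} (hs : 0 < s) : BddBelow {x : ℝ | s ≤ cdf μ x} := by
  obtain ⟨b, hb⟩ := eventually_atBot.1 ((tendsto_cdf_atBot μ).eventually_lt_const hs)
  refine ⟨b, fun x hx => ?_⟩
  by_contra hlt
  exact absurd (hb x (not_le.1 hlt).le) (not_lt.2 hx)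

lemma monotoneOn_quantile : MonotoneOn (quantile fun x => cdf μ x) (Ioo 0 1) := by
  intro s hs t ht hst
  exact csInf_le_csInf (quantile_set_bddBelow μ hs.1) (quantile_set_nonempty μ ht.2)
    fun x hx => hst.trans hx

lemma quantile_eq_zero {s : ℝ} (hs : s ≤ 0 ∨ 1 < s) : quantile (fun x => cdf μ x) s = 0 := by
  rcases hs with hs | hs
  · have : {x : ℝ | s ≤ cdf μ x} = univ := by
      ext x; simpa using hs.trans (cdf_nonneg μ x)
    simp [quantile, this]
  · have : {x : ℝ | s ≤ cdf μ x} = ∅ := by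
      ext x; simpa using (cdf_le_one μ x).trans_lt hs
    simp [quantile, this]

/-- `Q` is monotone on `(0, 1)` and vanishes outside `(0, 1]` by the default value of `sInf`. The
remaining point `s = 1` is harmless, since subsets of a singleton are measurable. -/
lemma measurable_quantile : Measurable (quantile fun x => cdf μ x) := by
  set Q := quantile fun x => cdf μ x with hQ
  refine measurable_of_Iic fun c => ?_
  have hdec : Q ⁻¹' Iic c = (Q ⁻¹' Iic c ∩ Ioo 0 1) ∪ ((Q ⁻¹' Iic c ∩ {1}) ∪
      ((Iic 0 ∪ Ioi 1) ∩ {_s | (0 : ℝ) ≤ c})) := by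
    ext s
    by_cases h : s ≤ 0 ∨ 1 < s
    · have h1 : Q s = 0 := quantile_eq_zero μ h
      simp only [mem_preimage, mem_Iic, mem_union, mem_inter_iff, mem_Ioo, mem_singleton_iff,
        mem_Ioi, mem_ofPred_eq, h1, h, true_and]
      tauto
    · push Not at h
      have : s ∈ Ioo (0 : ℝ) 1 ∨ s = 1 := by
        rcases h.2.lt_or_eq with h' | h'
        · exact Or.inl ⟨h.1, h'⟩
        · exact Or.inr h'
      have h2 : ¬ (s ∈ Iic (0 : ℝ) ∪ Ioi 1) := by simp [h]
      simp only [mem_union, mem_inter_iff, mem_singleton_iff] at this h2 ⊢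
      tauto
  rw [hdec]
  refine MeasurableSet.union ?_ (MeasurableSet.union ?_ ?_)
  · refine OrdConnected.measurableSet ⟨?_⟩
    intro x hx y hy z hz
    have hz' : z ∈ Ioo (0 : ℝ) 1 := ⟨hx.2.1.trans_le hz.1, hz.2.trans_lt hy.2.2⟩
    exact ⟨(monotoneOn_quantile μ hz' hy.2 hz.2).trans hy.1, hz'⟩
  · exact (subsingleton_singleton.anti inter_subset_right).measurableSet
  · exact (measurableSet_Iic.union measurableSet_Ioi).inter (MeasurableSet.const _)

end Quantile

/-! ### Potter bounds from regular variation and monotonicity. -/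

section Potter

lemma tendsto_tail_ratio {f ℓ : ℝ → ℝ} {γ : ℝ} (hℓ : SlowlyVaryingAtZero ℓ)
    (hf : ∀ s ∈ Ioo (0 : ℝ) 1, f s = s ^ (-γ) * ℓ s) {c : ℝ} (hc : c ∈ Ioo (0 : ℝ) 1) :
    Tendsto (fun s => f (c * s) / f s) (𝓝[>] 0) (𝓝 (c ^ (-γ))) := by
  have h := (hℓ.2 c hc.1).const_mul (c ^ (-γ))
  rw [mul_one] at h
  refine h.congr' ?_
  filter_upwards [Ioo_mem_nhdsGT (zero_lt_one' ℝ)] with s hs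
  have hcs : c * s ∈ Ioo (0 : ℝ) 1 :=
    ⟨mul_pos hc.1 hs.1, by nlinarith [hc.1, hc.2, hs.1, hs.2]⟩
  rw [hf s hs, hf _ hcs, Real.mul_rpow hc.1.le hs.1.le]
  have : s ^ (-γ) ≠ 0 := (Real.rpow_pos_of_pos hs.1 _).ne'
  rw [mul_assoc, mul_div_assoc, mul_div_mul_left _ _ this]

/-- Potter-type bounds for a decreasing function that is regularly varying at `0`. -/
lemma potter_bounds {f : ℝ → ℝ} {γ : ℝ} (hanti : AntitoneOn f (Ioo 0 1)) {δ : ℝ} (hδ : 0 < δ)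
    (hpos : ∀ s ∈ Ioo (0 : ℝ) δ, 0 < f s)
    (hlim : Tendsto (fun s => f (Real.exp (-1) * s) / f s) (𝓝[>] 0) (𝓝 (Real.exp γ)))
    {a b : ℝ} (ha0 : 0 < a) (ha : a < γ) (hb : γ < b) :
    ∃ v₀ ∈ Ioo (0 : ℝ) 1, ∀ v ∈ Ioo 0 v₀, ∀ u ∈ Ioo (0 : ℝ) 1,
      0 ≤ Real.log (f (u * v) / f v) ∧
      a * (-Real.log u - 1) ≤ Real.log (f (u * v) / f v) ∧
      Real.log (f (u * v) / f v) ≤ b * (-Real.log u + 1) := by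
  have hev : ∀ᶠ s in 𝓝[>] (0 : ℝ), f (Real.exp (-1) * s) / f s ∈ Ioo (Real.exp a) (Real.exp b) :=
    hlim (Ioo_mem_nhds (Real.exp_lt_exp.2 ha) (Real.exp_lt_exp.2 hb))
  obtain ⟨w, hw0, hw⟩ := mem_nhdsGT_iff_exists_Ioo_subset.1 hev
  have hw0 : 0 < w := hw0
  refine ⟨min (min w δ) (1 / 2), ⟨by positivity, (min_le_right _ _).trans_lt (by norm_num)⟩, ?_⟩
  intro v hv u hu
  have hvw : v < w := hv.2.trans_le ((min_le_left _ _).trans (min_le_left _ _))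
  have hvδ : v < δ := hv.2.trans_le ((min_le_left _ _).trans (min_le_right _ _))
  have hv1 : v < 1 := hv.2.trans_le ((min_le_right _ _).trans (by norm_num))
  have hv0 := hv.1
  have hfpos : ∀ s, 0 < s → s ≤ v → 0 < f s := fun s h0 h1 => hpos s ⟨h0, h1.trans_lt hvδ⟩
  have hfv := hfpos v hv0 le_rfl
  have hc1 : Real.exp (-1) ≤ 1 := Real.exp_le_one_iff.2 (by norm_num)
  have hlog : ∀ s, 0 < s → s ≤ v → Real.log (f (s) / f v) = Real.log (f s) - Real.log (f v) :=
    fun s h0 h1 => Real.log_div (hfpos s h0 h1).ne' hfv.ne'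
  -- Along the geometric sequence `e^{-n} v`, each step raises `log f` by an amount between `a` and
  -- `b`.
  have hiter : ∀ n : ℕ, a * n ≤ Real.log (f (Real.exp (-(n : ℝ)) * v)) - Real.log (f v) ∧
      Real.log (f (Real.exp (-(n : ℝ)) * v)) - Real.log (f v) ≤ b * n := by
    intro n
    induction n with
    | zero => simp
    | succ n ih =>
      set s := Real.exp (-(n : ℝ)) * v with hs
      have hs0 : 0 < s := by positivity
      have hsv : s ≤ v := by
        have : Real.exp (-(n : ℝ)) ≤ 1 := Real.exp_le_one_iff.2 (by simp)
        nlinarith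
      have hs' : Real.exp (-((n + 1 : ℕ) : ℝ)) * v = Real.exp (-1) * s := by
        rw [hs, ← mul_assoc, ← Real.exp_add]; push_cast; ring_nf
      have hmem : f (Real.exp (-1) * s) / f s ∈ Ioo (Real.exp a) (Real.exp b) :=
        hw ⟨hs0, hsv.trans_lt hvw⟩
      have hcs : 0 < f (Real.exp (-1) * s) := hfpos _ (by positivity) (by nlinarith)
      have hfs := hfpos s hs0 hsv
      have hl := Real.log_div hcs.ne' hfs.ne'
      have h1 : a ≤ Real.log (f (Real.exp (-1) * s) / f s) := by
        rw [Real.le_log_iff_exp_le (by positivity)]; exact hmem.1.le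
      have h2 : Real.log (f (Real.exp (-1) * s) / f s) ≤ b := by
        rw [Real.log_le_iff_le_exp (by positivity)]; exact hmem.2.le
      rw [hs', Nat.cast_succ]
      constructor <;> linarith [ih.1, ih.2]
  have huv0 : 0 < u * v := mul_pos hu.1 hv0
  have huv : u * v ≤ v := by nlinarith [hu.2]
  have hmono : ∀ s t, 0 < s → s ≤ t → t ≤ v → Real.log (f t) ≤ Real.log (f s) := by
    intro s t h0 h1 h2
    exact Real.log_le_log (hfpos t (h0.trans_le h1) h2)
      (hanti ⟨h0, (h1.trans h2).trans_lt hv1⟩ ⟨h0.trans_le h1, h2.trans_lt hv1⟩ h1)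
  have hE : 0 < -Real.log u := by linarith [Real.log_neg hu.1 hu.2]
  -- Now `u` lies between `e^{-(n+1)}` and `e^{-n}`; monotonicity of `f` interpolates at the cost of
  -- one step, whence the `∓ 1` in the bounds.
  set n := ⌊-Real.log u⌋₊ with hn
  have hn1 : (n : ℝ) ≤ -Real.log u := Nat.floor_le hE.le
  have hn2 : -Real.log u < n + 1 := Nat.lt_floor_add_one _
  have hu1 : u ≤ Real.exp (-(n : ℝ)) := by
    rw [← Real.log_le_iff_le_exp hu.1]; linarith
  have hu2 : Real.exp (-((n + 1 : ℕ) : ℝ)) ≤ u := by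
    rw [← Real.le_log_iff_exp_le hu.1]; push_cast; linarith
  have hexp : Real.exp (-(n : ℝ)) ≤ 1 := Real.exp_le_one_iff.2 (by simp)
  rw [hlog _ huv0 huv]
  refine ⟨?_, ?_, ?_⟩
  · linarith [hmono _ _ huv0 huv le_rfl]
  · have h1 := hmono (u * v) (Real.exp (-(n : ℝ)) * v) huv0 (by gcongr) (by nlinarith)
    have h2 := (hiter n).1
    nlinarith
  · have h1 := hmono (Real.exp (-((n + 1 : ℕ) : ℝ)) * v) (u * v) (by positivity) (by gcongr) huv
    have h2 := (hiter (n + 1)).2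
    push_cast at h1 h2
    have hb0 : 0 < b := ha0.trans (ha.trans hb)
    nlinarith

end Potter

/-! ### Moments of variables comparable to an exponential one. -/

section Moments

/-- The function `x^q e^{-θx}` peaks at `x = q/θ`; the proof is `1 + y ≤ e^y` at `y = θx/q - 1`,
raised to the power `q`. -/
lemma rpow_le_mul_exp {x q θ : ℝ} (hx : 0 ≤ x) (hq : 0 < q) (hθ : 0 < θ) :
    x ^ q ≤ (q / (θ * Real.exp 1)) ^ q * Real.exp (θ * x) := by
  have h1 : x ≤ (q / (θ * Real.exp 1)) * Real.exp (θ * x / q) := by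
    have h := Real.add_one_le_exp (θ * x / q - 1)
    rw [sub_add_cancel, Real.exp_sub] at h
    calc x = (q / θ) * (θ * x / q) := by field_simp
      _ ≤ (q / θ) * (Real.exp (θ * x / q) / Real.exp 1) := by gcongr
      _ = _ := by field_simp
  calc x ^ q ≤ ((q / (θ * Real.exp 1)) * Real.exp (θ * x / q)) ^ q :=
        Real.rpow_le_rpow hx h1 hq.le
    _ = _ := by
      rw [Real.mul_rpow (by positivity) (by positivity), ← Real.exp_mul]
      congr 2
      field_simp

lemma integrable_rpow_neg_unif01 {θ : ℝ} (hθ : θ < 1) :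
    Integrable (fun u : ℝ => u ^ (-θ)) unif01 := by
  have := (intervalIntegral.intervalIntegrable_rpow' (a := 0) (b := 1)
    (show -1 < -θ by linarith)).1
  exact this.mono_set Ioo_subset_Ioc_self

lemma integral_rpow_neg_unif01 {θ : ℝ} (hθ : θ < 1) :
    ∫ u, u ^ (-θ) ∂unif01 = 1 / (1 - θ) := by
  rw [unif01, ← integral_Ioc_eq_integral_Ioo, ← intervalIntegral.integral_of_le zero_le_one,
    integral_rpow (Or.inl (by linarith)), Real.one_rpow, Real.zero_rpow (by linarith)]
  ring

/-- Moment bounds for a variable squeezed between affine functions of an exponential variable. -/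
lemma moment_bounds {y : ℝ → ℝ} (hy : Measurable y) {a b θ q : ℝ} (ha : 0 < a) (hb : 0 < b)
    (hθ0 : 0 < θ) (hθ : θ < 1) (hq : 0 < q)
    (h : ∀ u ∈ Ioo (0 : ℝ) 1, 0 ≤ y u ∧ a * (-Real.log u - 1) ≤ y u ∧
      y u ≤ b * (-Real.log u + 1)) :
    Integrable (fun u => y u ^ q) unif01 ∧
      Real.exp (-1) * (a * q / Real.exp 1) ^ q ≤ ∫ u, y u ^ q ∂unif01 ∧
      ∫ u, y u ^ q ∂unif01 ≤ Real.exp θ / (1 - θ) * (b * q / (θ * Real.exp 1)) ^ q := by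
  have hup : ∀ u ∈ Ioo (0 : ℝ) 1,
      y u ^ q ≤ (Real.exp θ * (b * q / (θ * Real.exp 1)) ^ q) * u ^ (-θ) := by
    intro u hu
    obtain ⟨h0, -, h2⟩ := h u hu
    have hE : 0 < -Real.log u := by linarith [Real.log_neg hu.1 hu.2]
    calc y u ^ q ≤ (b * (-Real.log u + 1)) ^ q := Real.rpow_le_rpow h0 h2 hq.le
      _ = b ^ q * (-Real.log u + 1) ^ q := Real.mul_rpow hb.le (by linarith)
      _ ≤ b ^ q * ((q / (θ * Real.exp 1)) ^ q * Real.exp (θ * (-Real.log u + 1))) := by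
        gcongr
        exact rpow_le_mul_exp (by linarith) hq hθ0
      _ = _ := by
        rw [mul_div_assoc, Real.mul_rpow hb.le (by positivity), Real.rpow_def_of_pos hu.1,
          mul_add, Real.exp_add, mul_one]
        ring_nf
  have hmeas : AEStronglyMeasurable (fun u => y u ^ q) unif01 :=
    (hy.pow_const q).aestronglyMeasurable
  have hdom : Integrable (fun u : ℝ => (Real.exp θ * (b * q / (θ * Real.exp 1)) ^ q) * u ^ (-θ))
      unif01 := (integrable_rpow_neg_unif01 hθ).const_mul _
  have hint : Integrable (fun u => y u ^ q) unif01 := by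
    refine hdom.mono' hmeas ?_
    filter_upwards [ae_unif01] with u hu
    rw [Real.norm_of_nonneg (Real.rpow_nonneg (h u hu).1 _)]
    exact hup u hu
  refine ⟨hint, ?_, ?_⟩
  -- On `u < e^{-q-1}` the lower bound gives `y ≥ aq`, and this event has probability `e^{-q-1}`;
  -- near this point the `q`-th moment concentrates.
  · set c := Real.exp (-q - 1) with hc
    have hc1 : c < 1 := Real.exp_lt_one_iff.2 (by linarith)
    have hc0 : 0 < c := Real.exp_pos _
    have hind : Integrable ((Ioo 0 c).indicator fun _ => (a * q) ^ q) unif01 :=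
      (integrable_const _).indicator measurableSet_Ioo
    have hle : ∫ u, (Ioo 0 c).indicator (fun _ => (a * q) ^ q) u ∂unif01 ≤
        ∫ u, y u ^ q ∂unif01 := by
      refine integral_mono_ae hind hint ?_
      filter_upwards [ae_unif01] with u hu
      obtain ⟨h0, h1, -⟩ := h u hu
      by_cases huc : u ∈ Ioo 0 c
      · rw [indicator_of_mem huc]
        refine Real.rpow_le_rpow (by positivity) (le_trans ?_ h1) hq.le
        have : Real.log u ≤ -q - 1 := (Real.log_le_iff_le_exp hu.1).2 huc.2.le
        gcongr
        linarith
      · rw [indicator_of_notMem huc]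
        exact Real.rpow_nonneg h0 _
    refine le_trans (le_of_eq ?_) hle
    rw [integral_indicator measurableSet_Ioo, unif01, Measure.restrict_restrict measurableSet_Ioo,
      inter_eq_left.2 (Ioo_subset_Ioo_right hc1.le), setIntegral_const]
    simp only [measureReal_def, Real.volume_Ioo, sub_zero, ENNReal.toReal_ofReal hc0.le,
      smul_eq_mul]
    rw [Real.div_rpow (by positivity) (by positivity), ← Real.exp_mul, one_mul, hc,
      show -q - 1 = -1 + -q by ring, Real.exp_add, Real.exp_neg q]
    field_simp
  · calc ∫ u, y u ^ q ∂unif01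
        ≤ ∫ u : ℝ, (Real.exp θ * (b * q / (θ * Real.exp 1)) ^ q) * u ^ (-θ) ∂unif01 := by
          refine integral_mono_ae hint hdom ?_
          filter_upwards [ae_unif01] with u hu using hup u hu
      _ = _ := by
        rw [integral_const_mul, integral_rpow_neg_unif01 hθ]
        ring

end Moments

/-! ### Uniform moment bounds for `Y(v)`. -/

section TailVariable

variable {μ : Measure ℝ} {Q : ℝ → ℝ} {γ : ℝ} {ℓ : ℝ → ℝ}

lemma measurable_Y (hQ : Measurable Q) : Measurable fun q : ℝ × ℝ => Y Q γ q.1 q.2 := by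
  unfold Y
  refine Measurable.ite (measurable_fst (measurableSet_singleton 0)) ?_ ?_
  · fun_prop
  · fun_prop

/-- Up to a constant, the `q`-th moment of `Y(v)` is `(γ q / e) ^ q`, with an arbitrarily small
exponential error, uniformly in small `v` and in `q`. -/
theorem moment_bounds_Y (hQ : Q = quantile fun x => cdf μ x) (hγ : 0 < γ)
    (hℓ : SlowlyVaryingAtZero ℓ) (hQℓ : ∀ s ∈ Ioo (0 : ℝ) 1, Q (1 - s) = s ^ (-γ) * ℓ s)
    {L : ℝ} (hL : 1 < L) :
    ∃ C, 0 < C ∧ ∃ v₀ ∈ Ioo (0 : ℝ) 1, ∀ v ∈ Ioo 0 v₀,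
      (∀ u ∈ Ioo (0 : ℝ) 1, 0 ≤ Y Q γ v u) ∧ ∀ q, 0 < q →
        Integrable (fun u => Y Q γ v u ^ q) unif01 ∧
        C⁻¹ * (γ * q / (L * Real.exp 1)) ^ q ≤ m Q γ q v ∧
        m Q γ q v ≤ C * (L * γ * q / Real.exp 1) ^ q := by
  have hQm : Measurable Q := hQ ▸ measurable_quantile μ
  obtain ⟨δ, hδ, -, hpos⟩ := hℓ.1
  have hanti : AntitoneOn (fun s => Q (1 - s)) (Ioo 0 1) := by
    intro s hs t ht hst
    rw [hQ]
    exact monotoneOn_quantile μ ⟨by linarith [ht.2], by linarith [ht.1]⟩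
      ⟨by linarith [hs.2], by linarith [hs.1]⟩ (by linarith)
  have hfpos : ∀ s ∈ Ioo (0 : ℝ) (min δ 1), 0 < Q (1 - s) := by
    intro s hs
    rw [hQℓ s ⟨hs.1, hs.2.trans_le (min_le_right _ _)⟩]
    exact mul_pos (Real.rpow_pos_of_pos hs.1 _) (hpos s ⟨hs.1, hs.2.trans_le (min_le_left _ _)⟩)
  have hlim := tendsto_tail_ratio (f := fun s => Q (1 - s)) hℓ hQℓ (c := Real.exp (-1))
    ⟨Real.exp_pos _, Real.exp_lt_one_iff.2 (by norm_num)⟩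
  rw [← Real.exp_mul, show -1 * -γ = γ by ring] at hlim
  -- The upper bound loses twice, through the slope `√L γ` and through `θ = 1/√L`; the two losses
  -- multiply to `L`.
  have hs1 : 1 < √L := by rw [Real.lt_sqrt] <;> linarith
  have hss : √L * √L = L := Real.mul_self_sqrt (by linarith)
  set θ := (√L)⁻¹ with hθ
  have hθ0 : 0 < θ := by positivity
  have hθ1 : θ < 1 := inv_lt_one_of_one_lt₀ hs1
  obtain ⟨v₀, hv₀, hP⟩ := potter_bounds hanti (lt_min hδ one_pos) hfpos hlim
    (a := γ / L) (b := √L * γ) (by positivity) (div_lt_self hγ hL) (by nlinarith)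
  have hC1 : 0 < Real.exp θ / (1 - θ) := div_pos (Real.exp_pos _) (by linarith)
  refine ⟨Real.exp 1 + Real.exp θ / (1 - θ), by positivity, v₀, hv₀, fun v hv => ?_⟩
  have hY : ∀ u, Y Q γ v u = Real.log (Q (1 - u * v) / Q (1 - v)) := fun u => by
    simp [Y, hv.1.ne']
  have hPv := hP v hv
  simp_rw [← hY] at hPv
  refine ⟨fun u hu => (hPv u hu).1, fun q hq => ?_⟩
  obtain ⟨h1, h2, h3⟩ := moment_bounds (y := Y Q γ v)
    ((measurable_Y hQm).comp (measurable_prodMk_left (x := v)))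
    (by positivity) (by positivity) hθ0 hθ1 hq hPv
  refine ⟨h1, le_trans ?_ h2, h3.trans ?_⟩
  · rw [Real.exp_neg, show γ / L * q / Real.exp 1 = γ * q / (L * Real.exp 1) by field_simp]
    gcongr
    linarith
  · rw [show √L * γ * q / (θ * Real.exp 1) = (√L * √L) * γ * q / Real.exp 1 by
      rw [hθ]; field_simp, hss]
    gcongr
    linarith [Real.exp_pos 1]

end TailVariable

/-! ### Taylor estimates for characteristic functions. -/

section CharFunTools

lemma norm_pow_sub_pow_le {a b : ℂ} (ha : ‖a‖ ≤ 1) (hb : ‖b‖ ≤ 1) (k : ℕ) :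
    ‖a ^ k - b ^ k‖ ≤ k * ‖a - b‖ := by
  induction k with
  | zero => simp
  | succ k ih =>
    have h : a ^ (k + 1) - b ^ (k + 1) = a ^ k * (a - b) + (a ^ k - b ^ k) * b := by ring
    rw [h]
    refine (norm_add_le _ _).trans ?_
    rw [norm_mul, norm_mul, norm_pow]
    have h1 : ‖a‖ ^ k * ‖a - b‖ ≤ 1 * ‖a - b‖ := by
      gcongr
      exact pow_le_one₀ (norm_nonneg _) ha
    have h2 : ‖a ^ k - b ^ k‖ * ‖b‖ ≤ k * ‖a - b‖ * 1 := by gcongr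
    push_cast
    linarith

/-- Compare `φ ^ κ` with `(e^{c/κ}) ^ κ = e^c`. The condition `c.re ≤ 0` keeps `e^{c/κ}` in the unit
disc, so the powers differ by at most `κ` times the difference of the bases. -/
lemma tendsto_pow_exp {κ : ℕ → ℕ} {φ : ℕ → ℂ} {c : ℂ} (hc : c.re ≤ 0)
    (hκ : Tendsto κ atTop atTop) (hφ : ∀ n, ‖φ n‖ ≤ 1)
    (h : Tendsto (fun n => (κ n : ℂ) * (φ n - 1)) atTop (𝓝 c)) :
    Tendsto (fun n => φ n ^ κ n) atTop (𝓝 (Complex.exp c)) := by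
  rw [tendsto_iff_norm_sub_tendsto_zero] at h ⊢
  have hκ' : Tendsto (fun n => (κ n : ℝ)) atTop atTop := tendsto_natCast_atTop_atTop.comp hκ
  have hlim : Tendsto (fun n => ‖(κ n : ℂ) * (φ n - 1) - c‖ + ‖c‖ ^ 2 / κ n) atTop (𝓝 0) := by
    simpa using h.add (hκ'.const_div_atTop (‖c‖ ^ 2))
  refine squeeze_zero' (Eventually.of_forall fun _ => norm_nonneg _) ?_ hlim
  filter_upwards [hκ'.eventually_ge_atTop 1, hκ'.eventually_ge_atTop ‖c‖] with n h1 hcn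
  have hk0 : (κ n : ℝ) ≠ 0 := by positivity
  have hk0' : (κ n : ℂ) ≠ 0 := by exact_mod_cast hk0
  set w := Complex.exp (c / κ n) with hw
  have hwk : w ^ κ n = Complex.exp c := by
    rw [hw, ← Complex.exp_nat_mul, mul_div_cancel₀ _ hk0']
  have hw1 : ‖w‖ ≤ 1 := by
    rw [hw, Complex.norm_exp, Real.exp_le_one_iff]
    rw [Complex.div_natCast_re]
    exact div_nonpos_of_nonpos_of_nonneg hc (by positivity)
  have hsmall : ‖c / κ n‖ ≤ 1 := by
    rw [norm_div, Complex.norm_natCast]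
    exact div_le_one_of_le₀ hcn (by positivity)
  have hq := Complex.norm_exp_sub_one_sub_id_le hsmall
  rw [← hw] at hq
  calc ‖φ n ^ κ n - Complex.exp c‖ = ‖φ n ^ κ n - w ^ κ n‖ := by rw [hwk]
    _ ≤ κ n * ‖φ n - w‖ := norm_pow_sub_pow_le (hφ n) hw1 _
    _ = ‖((κ n : ℂ) * (φ n - 1) - c) - κ n * (w - 1 - c / κ n)‖ := by
      rw [← Complex.norm_natCast, ← norm_mul]
      congr 1
      field_simp
      ring
    _ ≤ ‖(κ n : ℂ) * (φ n - 1) - c‖ + κ n * ‖c / κ n‖ ^ 2 := by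
      refine (norm_sub_le _ _).trans ?_
      rw [norm_mul (κ n : ℂ) (w - 1 - c / κ n), Complex.norm_natCast]
      gcongr
    _ = _ := by
      rw [norm_div, Complex.norm_natCast]
      field_simp

/-- Interpolates between the quadratic bound for `|x| ≤ 1` and the linear one beyond. A fractional
exponent is essential: moments of `Y^p` are controlled only for `r` below the growth rate of `log k
/ p`. -/
lemma norm_exp_mul_I_sub_le (x : ℝ) {r : ℝ} (hr1 : 1 ≤ r) (hr2 : r ≤ 2) :
    ‖Complex.exp (x * Complex.I) - 1 - x * Complex.I‖ ≤ 3 * |x| ^ r := by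
  have hn : ‖(x * Complex.I : ℂ)‖ = |x| := by simp
  rcases le_or_gt |x| 1 with h | h
  · have h1 := Complex.norm_exp_sub_one_sub_id_le (x := x * Complex.I) (by rwa [hn])
    rw [hn] at h1
    have h2 : |x| ^ (2 : ℝ) ≤ |x| ^ r :=
      Real.rpow_le_rpow_of_exponent_ge_of_imp (abs_nonneg _) h hr2 (fun _ h0 => by linarith)
    rw [Real.rpow_two] at h2
    nlinarith [Real.rpow_nonneg (abs_nonneg x) r]
  · have h1 : ‖Complex.exp (x * Complex.I) - 1 - x * Complex.I‖ ≤ 1 + 1 + |x| := by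
      refine (norm_sub_le _ _).trans (add_le_add ((norm_sub_le _ _).trans ?_) hn.le)
      rw [Complex.norm_exp_ofReal_mul_I, norm_one]
    have h2 : |x| ≤ |x| ^ r := by
      simpa using Real.rpow_le_rpow_of_exponent_le h.le hr1
    linarith

lemma norm_exp_mul_I_sub_quadratic_le (x : ℝ) {s : ℝ} (hs1 : 2 ≤ s) (hs2 : s ≤ 3) :
    ‖Complex.exp (x * Complex.I) - 1 - x * Complex.I + (x ^ 2 / 2 : ℝ)‖ ≤ 4 * |x| ^ s := by
  have hn : ‖(x * Complex.I : ℂ)‖ = |x| := by simp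
  have hsq : (x * Complex.I : ℂ) ^ 2 = -(x : ℂ) ^ 2 := by
    rw [mul_pow, Complex.I_sq]; ring
  rcases le_or_gt |x| 1 with h | h
  · have h1 := Complex.exp_bound (x := x * Complex.I) (by rwa [hn]) (n := 3) (by norm_num)
    rw [hn] at h1
    simp only [Finset.sum_range_succ, Finset.sum_range_zero, hsq] at h1
    have h2 : |x| ^ (3 : ℝ) ≤ |x| ^ s :=
      Real.rpow_le_rpow_of_exponent_ge_of_imp (abs_nonneg _) h hs2 (fun _ h0 => by linarith)
    rw [show (3 : ℝ) = (3 : ℕ) by norm_num, Real.rpow_natCast] at h2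
    have h3 : (0 : ℝ) ≤ |x| ^ 3 := by positivity
    refine le_trans (le_of_eq ?_) (h1.trans ?_)
    · congr 1
      push_cast
      norm_num [Nat.factorial]
      ring
    · norm_num [Nat.factorial]
      linarith
  · have h1 : ‖Complex.exp (x * Complex.I) - 1 - x * Complex.I + (x ^ 2 / 2 : ℝ)‖ ≤
        1 + 1 + |x| + x ^ 2 / 2 := by
      refine (norm_add_le _ _).trans (add_le_add ((norm_sub_le _ _).trans
        (add_le_add ((norm_sub_le _ _).trans ?_) hn.le)) ?_)
      · rw [Complex.norm_exp_ofReal_mul_I, norm_one]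
      · rw [Complex.norm_real, Real.norm_of_nonneg (by positivity)]
    have h2 : |x| ^ (2 : ℝ) ≤ |x| ^ s := Real.rpow_le_rpow_of_exponent_le h.le hs1
    rw [Real.rpow_two] at h2
    nlinarith [sq_abs x]

variable {Ω : Type*} [MeasurableSpace Ω] {ν : Measure Ω} [IsProbabilityMeasure ν] {X : Ω → ℝ}

lemma integrable_cexp_mul_I (hX : Integrable X ν) :
    Integrable (fun ω => Complex.exp (X ω * Complex.I)) ν := by
  refine Integrable.of_bound (C := 1) ?_ (ae_of_all _ fun ω => ?_)
  · exact (by fun_prop : Continuous fun x : ℝ => Complex.exp (x * Complex.I)).comp_aestronglyMeasurable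
      hX.aestronglyMeasurable
  · rw [Complex.norm_exp_ofReal_mul_I]

lemma norm_integral_cexp_sub_le (hX : Integrable X ν) {r : ℝ} (hr1 : 1 ≤ r) (hr2 : r ≤ 2)
    (hXr : Integrable (fun ω => |X ω| ^ r) ν) :
    ‖∫ ω, Complex.exp (X ω * Complex.I) ∂ν - 1 - (∫ ω, X ω ∂ν : ℝ) * Complex.I‖ ≤
      3 * ∫ ω, |X ω| ^ r ∂ν := by
  have h1 := integrable_cexp_mul_I hX
  have h2 : Integrable (fun ω => (X ω : ℂ) * Complex.I) ν := hX.ofReal.mul_const _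
  have h12 : Integrable (fun ω => Complex.exp (X ω * Complex.I) - 1) ν :=
    h1.sub (integrable_const _)
  have : ∫ ω, Complex.exp (X ω * Complex.I) ∂ν - 1 - (∫ ω, X ω ∂ν : ℝ) * Complex.I =
      ∫ ω, (Complex.exp (X ω * Complex.I) - 1 - X ω * Complex.I) ∂ν := by
    rw [integral_sub h12 h2, integral_sub h1 (integrable_const _),
      integral_mul_const, integral_complex_ofReal]
    simp
  rw [this, ← integral_const_mul]
  exact norm_integral_le_of_norm_le (hXr.const_mul 3)
    (ae_of_all _ fun ω => norm_exp_mul_I_sub_le _ hr1 hr2)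

lemma norm_integral_cexp_sub_quadratic_le (hX : Integrable X ν)
    (hX2 : Integrable (fun ω => X ω ^ 2) ν) {s : ℝ} (hs1 : 2 ≤ s) (hs2 : s ≤ 3)
    (hXs : Integrable (fun ω => |X ω| ^ s) ν) :
    ‖∫ ω, Complex.exp (X ω * Complex.I) ∂ν - 1 - (∫ ω, X ω ∂ν : ℝ) * Complex.I +
      ((∫ ω, X ω ^ 2 ∂ν) / 2 : ℝ)‖ ≤ 4 * ∫ ω, |X ω| ^ s ∂ν := by
  have h1 := integrable_cexp_mul_I hX
  have h2 : Integrable (fun ω => (X ω : ℂ) * Complex.I) ν := hX.ofReal.mul_const _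
  have h12 : Integrable (fun ω => Complex.exp (X ω * Complex.I) - 1) ν :=
    h1.sub (integrable_const _)
  have h3 : Integrable (fun ω => ((X ω ^ 2 / 2 : ℝ) : ℂ)) ν := (hX2.div_const 2).ofReal
  have h123 : Integrable (fun ω => Complex.exp (X ω * Complex.I) - 1 - X ω * Complex.I) ν :=
    h12.sub h2
  have : ∫ ω, Complex.exp (X ω * Complex.I) ∂ν - 1 - (∫ ω, X ω ∂ν : ℝ) * Complex.I +
      ((∫ ω, X ω ^ 2 ∂ν) / 2 : ℝ) =
      ∫ ω, (Complex.exp (X ω * Complex.I) - 1 - X ω * Complex.I + (X ω ^ 2 / 2 : ℝ)) ∂ν := by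
    rw [integral_add h123 h3, integral_sub h12 h2, integral_sub h1 (integrable_const _),
      integral_mul_const, integral_complex_ofReal, integral_complex_ofReal, integral_div]
    simp
  rw [this, ← integral_const_mul]
  exact norm_integral_le_of_norm_le (hXs.const_mul 4)
    (ae_of_all _ fun ω => norm_exp_mul_I_sub_quadratic_le _ hs1 hs2)

end CharFunTools

/-! ### Lyapunov-type moment ratios. -/

section MomentRatio

variable {μ : Measure ℝ} {Q : ℝ → ℝ} {γ : ℝ} {ℓ : ℝ → ℝ}

lemma rpow_neg_le_exp {κ a q r : ℝ} (hκ : 0 < κ) (hr : 1 ≤ r) (h : a * q ≤ Real.log κ) :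
    κ ^ (1 - r) ≤ Real.exp (-((r - 1) * a * q)) := by
  rw [Real.rpow_def_of_pos hκ, Real.exp_le_exp]
  nlinarith

/-- Normalised moments of order slightly above one grow slower than the sample size. -/
theorem exists_tendsto_moment_ratio (hQ : Q = quantile fun x => cdf μ x) (hγ : 0 < γ)
    (hℓ : SlowlyVaryingAtZero ℓ) (hQℓ : ∀ s ∈ Ioo (0 : ℝ) 1, Q (1 - s) = s ^ (-γ) * ℓ s)
    {κ : ℕ → ℕ} (hκ : Tendsto κ atTop atTop) {q : ℕ → ℝ} (hq : Tendsto q atTop atTop)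
    {a : ℝ} (ha : 1 < a) (haq : ∀ᶠ n in atTop, a * q n ≤ Real.log (κ n))
    {v : ℕ → ℝ} (hv : Tendsto v atTop (𝓝[>] 0)) :
    ∃ r ∈ Ioo (1 : ℝ) (3 / 2), Tendsto (fun n => (κ n : ℝ) ^ (1 - r) *
      (m Q γ (r * q n) (v n) / m Q γ (q n) (v n) ^ r)) atTop (𝓝 0) := by
  -- The constraint `r < a` makes the final exponent negative; `r < 3/2` keeps `2r` at most `3`, as
  -- the second-order Taylor bound needs.
  obtain ⟨r, hr1, hr2⟩ := exists_between (lt_min ha (by norm_num : (1 : ℝ) < 3 / 2))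
  have hra : r < a := hr2.trans_le (min_le_left _ _)
  have hr32 : r < 3 / 2 := hr2.trans_le (min_le_right _ _)
  refine ⟨r, ⟨hr1, hr32⟩, ?_⟩
  have hr0 : 0 < r := by linarith
  -- Chosen so that `2rη = d`: the moment bounds then consume half of the available gap `(r-1)(a-r)
  -- = 2d`.
  set η := (a - r) * (r - 1) / (4 * r) with hη
  have hη0 : 0 < η := by
    have := mul_pos (sub_pos.2 hra) (sub_pos.2 hr1)
    positivity
  obtain ⟨C, hC, v₀, hv₀, hB⟩ := moment_bounds_Y hQ hγ hℓ hQℓ (L := Real.exp η)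
    (Real.one_lt_exp_iff.2 hη0)
  set d := (r - 1) * (a - r) / 2 with hd
  have hd0 : 0 < d := by
    have := mul_pos (sub_pos.2 hra) (sub_pos.2 hr1)
    rw [hd]; linarith
  have hlim : Tendsto (fun n => C ^ (1 + r) * Real.exp (-(d * q n))) atTop (𝓝 0) := by
    simpa using (Real.tendsto_exp_neg_atTop_nhds_zero.comp (hq.const_mul_atTop hd0)).const_mul
      (C ^ (1 + r))
  refine squeeze_zero' (g := fun n => C ^ (1 + r) * Real.exp (-(d * q n))) ?_ ?_ hlim
  · filter_upwards [hv (Ioo_mem_nhdsGT hv₀.1), hq.eventually_gt_atTop 0] with n hvn hqn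
    have h1 := ((hB _ hvn).2 (q n) hqn).2.1
    have h2 := ((hB _ hvn).2 (r * q n) (by positivity)).2.1
    have : 0 ≤ m Q γ (r * q n) (v n) := le_trans (by positivity) h2
    have : 0 ≤ m Q γ (q n) (v n) := le_trans (by positivity) h1
    positivity
  · filter_upwards [hv (Ioo_mem_nhdsGT hv₀.1), hq.eventually_gt_atTop 0, haq,
      hκ.eventually_gt_atTop 0] with n hvn hqn han hκn
    have h1 := ((hB _ hvn).2 (q n) hqn).2.1
    have h2 := ((hB _ hvn).2 (r * q n) (by positivity)).2.2
    have hκn' : (0 : ℝ) < κ n := by exact_mod_cast hκn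
    set e := Real.exp 1 with he
    set lo := C⁻¹ * (γ * q n / (Real.exp η * e)) ^ q n with hlo
    have hlo0 : 0 < lo := by positivity
    have hratio : C * (Real.exp η * γ * (r * q n) / e) ^ (r * q n) / lo ^ r =
        C ^ (1 + r) * Real.exp (r * q n * (2 * η + Real.log r)) := by
      rw [hlo, Real.mul_rpow (by positivity) (by positivity), ← Real.rpow_mul (by positivity),
        Real.inv_rpow hC.le, Real.rpow_add hC, Real.rpow_one, mul_comm (q n) r]
      have : Real.exp η * γ * (r * q n) / e =
          (γ * q n / (Real.exp η * e)) * Real.exp (2 * η + Real.log r) := by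
        rw [Real.exp_add, Real.exp_log hr0, two_mul, Real.exp_add]
        field_simp
      rw [this, Real.mul_rpow (by positivity) (by positivity), ← Real.exp_mul,
        mul_comm (2 * η + Real.log r)]
      have hne : (γ * q n / (Real.exp η * e)) ^ (r * q n) ≠ 0 := by positivity
      generalize (γ * q n / (Real.exp η * e)) ^ (r * q n) = A at hne
      field_simp
    have hm0 : 0 ≤ m Q γ (r * q n) (v n) :=
      le_trans (by positivity) ((hB _ hvn).2 (r * q n) (by positivity)).2.1
    have hm1 : 0 ≤ m Q γ (q n) (v n) := hlo0.le.trans h1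
    calc (κ n : ℝ) ^ (1 - r) * (m Q γ (r * q n) (v n) / m Q γ (q n) (v n) ^ r)
        ≤ Real.exp (-((r - 1) * a * q n)) *
          (C * (Real.exp η * γ * (r * q n) / e) ^ (r * q n) / lo ^ r) := by
          refine mul_le_mul (rpow_neg_le_exp hκn' hr1.le han) ?_ (by positivity) (by positivity)
          gcongr
      _ = C ^ (1 + r) * Real.exp (r * q n * (2 * η + Real.log r) - (r - 1) * a * q n) := by
          rw [hratio, Real.exp_sub, Real.exp_neg]; field_simp
      _ ≤ _ := by
          gcongr
          have hlog := Real.log_le_sub_one_of_pos hr0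
          have h4 : r * (2 * η) = (a - r) * (r - 1) / 2 := by rw [hη]; field_simp; ring
          have h5 : r * Real.log r ≤ r * (r - 1) := by gcongr
          have h6 : r * (2 * η + Real.log r) - (r - 1) * a ≤ -d := by
            rw [mul_add, h4, hd]; nlinarith
          nlinarith

/-- The squared mean of `Y(v)^p` is negligible with respect to its second moment. -/
theorem tendsto_sq_mean_ratio (hQ : Q = quantile fun x => cdf μ x) (hγ : 0 < γ)
    (hℓ : SlowlyVaryingAtZero ℓ) (hQℓ : ∀ s ∈ Ioo (0 : ℝ) 1, Q (1 - s) = s ^ (-γ) * ℓ s)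
    {q : ℕ → ℝ} (hq : Tendsto q atTop atTop) {v : ℕ → ℝ} (hv : Tendsto v atTop (𝓝[>] 0)) :
    Tendsto (fun n => m Q γ (q n) (v n) ^ 2 / m Q γ (2 * q n) (v n)) atTop (𝓝 0) := by
  -- Any `L` with `L² < 2` would do; for `5/4` the bases compare as `L²/2 = 25/32 < 1`.
  obtain ⟨C, hC, v₀, hv₀, hB⟩ := moment_bounds_Y hQ hγ hℓ hQℓ (L := 5 / 4) (by norm_num)
  have hlim : Tendsto (fun n => C ^ 3 * (25 / 32 : ℝ) ^ (2 * q n)) atTop (𝓝 0) := by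
    simpa using ((tendsto_rpow_atTop_of_base_lt_one (25 / 32 : ℝ) (by norm_num)
      (by norm_num)).comp (hq.const_mul_atTop (two_pos (α := ℝ)))).const_mul (C ^ 3)
  refine squeeze_zero' ?_ ?_ hlim
  · filter_upwards [hv (Ioo_mem_nhdsGT hv₀.1), hq.eventually_gt_atTop 0] with n hvn hqn
    have h2 := ((hB _ hvn).2 (2 * q n) (by positivity)).2.1
    have : 0 ≤ m Q γ (2 * q n) (v n) := le_trans (by positivity) h2
    positivity
  · filter_upwards [hv (Ioo_mem_nhdsGT hv₀.1), hq.eventually_gt_atTop 0] with n hvn hqn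
    have h0 := ((hB _ hvn).2 (q n) hqn).2.1
    have h1 := ((hB _ hvn).2 (q n) hqn).2.2
    have h2 := ((hB _ hvn).2 (2 * q n) (by positivity)).2.1
    have h0' : 0 ≤ m Q γ (q n) (v n) := le_trans (by positivity) h0
    set e := Real.exp 1 with he
    set lo := (γ * (2 * q n) / (5 / 4 * e)) with hlo
    have hlo0 : 0 < lo := by positivity
    calc m Q γ (q n) (v n) ^ 2 / m Q γ (2 * q n) (v n)
        ≤ (C * (5 / 4 * γ * q n / e) ^ q n) ^ 2 / (C⁻¹ * lo ^ (2 * q n)) := by gcongr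
      _ = _ := by
        have : 5 / 4 * γ * q n / e = lo * (25 / 32) := by
          rw [hlo]; field_simp; norm_num
        rw [this, mul_pow, ← Real.rpow_natCast, ← Real.rpow_natCast, ← Real.rpow_mul (by positivity),
          Nat.cast_ofNat, mul_comm (q n) 2, Real.mul_rpow (by positivity) (by positivity)]
        have hne : lo ^ (2 * q n) ≠ 0 := by positivity
        rw [Real.rpow_two]
        field_simp

end MomentRatio

/-! ### Quantitative expansion for a single normalised summand. -/

section Steps

variable {Ω : Type*} [MeasurableSpace Ω] {ν : Measure Ω} [IsProbabilityMeasure ν] {Z : Ω → ℝ}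

/-- The normalised summand has mean exactly `t / K`, so the first-order term produces `t I` and only
the remainder of order `r` is left. -/
lemma norm_charFun_mean_sub_le (hZ0 : ∀ᵐ ω ∂ν, 0 ≤ Z ω) (hZ : Integrable Z ν) {r : ℝ}
    (hr1 : 1 ≤ r) (hr2 : r ≤ 2) (hZr : Integrable (fun ω => Z ω ^ r) ν)
    (hM : 0 < ∫ ω, Z ω ∂ν) {K : ℝ} (hK : 0 < K) (t : ℝ) :
    ‖(K : ℂ) * (∫ ω, Complex.exp ((t * (1 / (K * ∫ ω, Z ω ∂ν) * Z ω) : ℝ) * Complex.I) ∂ν - 1) -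
      t * Complex.I‖ ≤ 3 * |t| ^ r * (K ^ (1 - r) * ((∫ ω, Z ω ^ r ∂ν) / (∫ ω, Z ω ∂ν) ^ r)) := by
  set M := ∫ ω, Z ω ∂ν with hMdef
  have hX : Integrable (fun ω => t * (1 / (K * M) * Z ω)) ν := (hZ.const_mul _).const_mul _
  have hXr : (fun ω => |t * (1 / (K * M) * Z ω)| ^ r) =ᵐ[ν]
      fun ω => |t| ^ r * (1 / (K * M)) ^ r * Z ω ^ r := by
    filter_upwards [hZ0] with ω hω
    rw [abs_mul, abs_of_nonneg (a := 1 / (K * M) * Z ω) (by positivity),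
      Real.mul_rpow (abs_nonneg _) (by positivity), Real.mul_rpow (by positivity) hω, mul_assoc]
  have h := norm_integral_cexp_sub_le hX hr1 hr2 ((hZr.const_mul _).congr hXr.symm)
  rw [integral_congr_ae hXr, integral_const_mul, integral_const_mul, integral_const_mul,
    ← hMdef] at h
  have hmean : t * (1 / (K * M) * M) = t / K := by field_simp
  rw [hmean] at h
  have hKc : (K : ℂ) ≠ 0 := by exact_mod_cast hK.ne'
  set φ := ∫ ω, Complex.exp ((t * (1 / (K * M) * Z ω) : ℝ) * Complex.I) ∂ν with hφ
  have heq : (K : ℂ) * (φ - 1) - t * Complex.I = K * (φ - 1 - ((t / K : ℝ) : ℂ) * Complex.I) := by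
    push_cast; field_simp
  rw [heq, norm_mul, Complex.norm_real, Real.norm_of_nonneg hK.le]
  calc K * ‖φ - 1 - ((t / K : ℝ) : ℂ) * Complex.I‖
      ≤ K * (3 * (|t| ^ r * (1 / (K * M)) ^ r * ∫ ω, Z ω ^ r ∂ν)) := by gcongr
    _ = _ := by
      rw [Real.div_rpow zero_le_one (by positivity), Real.one_rpow,
        Real.mul_rpow hK.le hM.le, Real.rpow_sub hK, Real.rpow_one]
      field_simp

/-- By `hMS` the variance is at least half the second moment, which replaces it at the cost of `2 ^
r`. Centring contributes `M^{2r} ≤ S^r`, hence the separate term `K ^ (1 - r)`. -/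
lemma norm_charFun_standardized_sub_le (hZ0 : ∀ᵐ ω ∂ν, 0 ≤ Z ω) (hZ : Integrable Z ν)
    (hZ2 : Integrable (fun ω => Z ω ^ 2) ν) {r : ℝ} (hr1 : 1 ≤ r) (hr2 : r ≤ 3 / 2)
    (hZr : Integrable (fun ω => Z ω ^ (2 * r)) ν) (hS : 0 < ∫ ω, Z ω ^ 2 ∂ν)
    (hMS : (∫ ω, Z ω ∂ν) ^ 2 ≤ (∫ ω, Z ω ^ 2 ∂ν) / 2) {K : ℝ} (hK : 0 < K) (t : ℝ) :
    ‖(K : ℂ) * (∫ ω, Complex.exp ((t * (1 / (√K * √(variance Z ν)) *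
        (Z ω - ∫ ω, Z ω ∂ν)) : ℝ) * Complex.I) ∂ν - 1) - (-(t ^ 2 / 2) : ℝ)‖ ≤
      4 * |t| ^ (2 * r) * 2 ^ r * (K ^ (1 - r) * ((∫ ω, Z ω ^ (2 * r) ∂ν) /
        (∫ ω, Z ω ^ 2 ∂ν) ^ r) + K ^ (1 - r)) := by
  set M := ∫ ω, Z ω ∂ν with hMdef
  set S := ∫ ω, Z ω ^ 2 ∂ν with hSdef
  have hM0 : 0 ≤ M := integral_nonneg_of_ae hZ0
  have hLp : MemLp Z 2 ν := (memLp_two_iff_integrable_sq hZ.aestronglyMeasurable).2 hZ2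
  have hvar : variance Z ν = S - M ^ 2 := by
    rw [variance_eq_sub hLp]; rfl
  have hvarS : S / 2 ≤ variance Z ν := by rw [hvar]; linarith
  have hvar0 : 0 < variance Z ν := by linarith
  set s := √(variance Z ν) with hs
  have hs2 : s ^ 2 = variance Z ν := Real.sq_sqrt hvar0.le
  have hs0 : 0 < s := Real.sqrt_pos.2 hvar0
  have hsK : 0 < √K := Real.sqrt_pos.2 hK
  have hK2 : √K ^ 2 = K := Real.sq_sqrt hK.le
  set c := 1 / (√K * s) with hc
  have hc0 : 0 < c := by positivity
  have hc2 : c ^ 2 = 1 / (K * variance Z ν) := by rw [hc, div_pow, mul_pow, hs2, hK2, one_pow]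
  have hX : Integrable (fun ω => t * (c * (Z ω - M))) ν :=
    ((hZ.sub (integrable_const _)).const_mul _).const_mul _
  have hZM2 : Integrable (fun ω => (Z ω - M) ^ 2) ν :=
    (hLp.sub (memLp_const M)).integrable_sq
  have hX2eq : (fun ω => (t * (c * (Z ω - M))) ^ 2) = fun ω => t ^ 2 * c ^ 2 * (Z ω - M) ^ 2 := by
    ext ω; ring
  have hX2 : Integrable (fun ω => (t * (c * (Z ω - M))) ^ 2) ν := by
    rw [hX2eq]; exact hZM2.const_mul _
  have hbound : ∀ᵐ ω ∂ν, |t * (c * (Z ω - M))| ^ (2 * r) ≤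
      |t| ^ (2 * r) * c ^ (2 * r) * (Z ω ^ (2 * r) + M ^ (2 * r)) := by
    filter_upwards [hZ0] with ω hω
    rw [abs_mul, abs_mul, abs_of_pos hc0, Real.mul_rpow (abs_nonneg _) (by positivity),
      Real.mul_rpow hc0.le (abs_nonneg _), mul_assoc]
    gcongr
    have hmax : |Z ω - M| ≤ max (Z ω) M := by
      rw [abs_le]
      constructor
      · linarith [le_max_right (Z ω) M]
      · linarith [le_max_left (Z ω) M]
    refine (Real.rpow_le_rpow (abs_nonneg _) hmax (by linarith)).trans ?_
    have h1 := Real.rpow_nonneg hω (2 * r)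
    have h2 := Real.rpow_nonneg hM0 (2 * r)
    rcases max_choice (Z ω) M with h | h <;> rw [h] <;> linarith
  have hdom : Integrable (fun ω => |t| ^ (2 * r) * c ^ (2 * r) * (Z ω ^ (2 * r) + M ^ (2 * r))) ν :=
    (hZr.add (integrable_const _)).const_mul _
  have hXr : Integrable (fun ω => |t * (c * (Z ω - M))| ^ (2 * r)) ν := by
    refine hdom.mono' ?_ ?_
    · exact (hX.aestronglyMeasurable.aemeasurable.abs.pow_const _).aestronglyMeasurable
    · filter_upwards [hbound] with ω hω
      rwa [Real.norm_of_nonneg (by positivity)]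
  have h := norm_integral_cexp_sub_quadratic_le hX hX2 (by linarith) (by linarith) hXr
  have hmean : ∫ ω, t * (c * (Z ω - M)) ∂ν = 0 := by
    rw [integral_const_mul, integral_const_mul, integral_sub hZ (integrable_const _)]
    simp [hMdef]
  have hsq : ∫ ω, (t * (c * (Z ω - M))) ^ 2 ∂ν = t ^ 2 / K := by
    rw [hX2eq, integral_const_mul, ← variance_eq_integral hZ.aemeasurable, hc2]
    field_simp
  rw [hmean, hsq] at h
  have hI : ∫ ω, |t * (c * (Z ω - M))| ^ (2 * r) ∂ν ≤
      |t| ^ (2 * r) * c ^ (2 * r) * (∫ ω, Z ω ^ (2 * r) ∂ν + M ^ (2 * r)) := by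
    refine (integral_mono_ae hXr hdom hbound).trans (le_of_eq ?_)
    rw [integral_const_mul, integral_add hZr (integrable_const _)]
    simp
  have hI0 : 0 ≤ ∫ ω, Z ω ^ (2 * r) ∂ν := integral_nonneg_of_ae (by
    filter_upwards [hZ0] with ω hω using Real.rpow_nonneg hω _)
  have hcr : c ^ (2 * r) ≤ 2 ^ r * (K ^ r)⁻¹ * (S ^ r)⁻¹ := by
    rw [Real.rpow_mul hc0.le, Real.rpow_two, hc2, ← Real.inv_rpow hK.le, ← Real.inv_rpow hS.le,
      ← Real.mul_rpow (by norm_num) (by positivity), ← Real.mul_rpow (by positivity) (by positivity)]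
    refine Real.rpow_le_rpow (by positivity) ?_ (by linarith)
    calc 1 / (K * variance Z ν) ≤ 1 / (K * (S / 2)) := by gcongr
      _ = _ := by field_simp
  have hMr : M ^ (2 * r) ≤ S ^ r := by
    rw [Real.rpow_mul hM0, Real.rpow_two]
    exact Real.rpow_le_rpow (by positivity) (by linarith) (by linarith)
  have hKc : (K : ℂ) ≠ 0 := by exact_mod_cast hK.ne'
  set φ := ∫ ω, Complex.exp ((t * (c * (Z ω - M)) : ℝ) * Complex.I) ∂ν with hφ
  have heq : (K : ℂ) * (φ - 1) - (-(t ^ 2 / 2) : ℝ) =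
      K * (φ - 1 - ((0 : ℝ) : ℂ) * Complex.I + ((t ^ 2 / K / 2 : ℝ) : ℂ)) := by
    push_cast; field_simp; ring
  rw [heq, norm_mul, Complex.norm_real, Real.norm_of_nonneg hK.le]
  calc K * ‖φ - 1 - ((0 : ℝ) : ℂ) * Complex.I + ((t ^ 2 / K / 2 : ℝ) : ℂ)‖
      ≤ K * (4 * (|t| ^ (2 * r) * (2 ^ r * (K ^ r)⁻¹ * (S ^ r)⁻¹) *
        (∫ ω, Z ω ^ (2 * r) ∂ν + S ^ r))) := by
        refine mul_le_mul_of_nonneg_left (h.trans ?_) hK.le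
        refine mul_le_mul_of_nonneg_left (hI.trans ?_) (by norm_num)
        gcongr
    _ = _ := by
      have hSr : S ^ r ≠ 0 := (Real.rpow_pos_of_pos hS r).ne'
      rw [Real.rpow_sub hK, Real.rpow_one]
      field_simp

end Steps

/-! ### Limits along deterministic levels tending to zero. -/

section Asymptotics

variable {μ : Measure ℝ} {Q : ℝ → ℝ} {γ : ℝ} {ℓ : ℝ → ℝ}

lemma eventually_moments (hQ : Q = quantile fun x => cdf μ x) (hγ : 0 < γ)
    (hℓ : SlowlyVaryingAtZero ℓ) (hQℓ : ∀ s ∈ Ioo (0 : ℝ) 1, Q (1 - s) = s ^ (-γ) * ℓ s)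
    {v : ℕ → ℝ} (hv : Tendsto v atTop (𝓝[>] 0)) :
    ∀ᶠ n in atTop, (∀ᵐ u ∂unif01, 0 ≤ Y Q γ (v n) u) ∧ ∀ q, 0 < q →
      Integrable (fun u => Y Q γ (v n) u ^ q) unif01 ∧ 0 < m Q γ q (v n) := by
  obtain ⟨C, hC, v₀, hv₀, hB⟩ := moment_bounds_Y hQ hγ hℓ hQℓ (L := 2) (by norm_num)
  filter_upwards [hv (Ioo_mem_nhdsGT hv₀.1)] with n hvn
  refine ⟨?_, fun q hq => ?_⟩
  · filter_upwards [ae_unif01] with u hu using (hB _ hvn).1 u hu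
  · obtain ⟨h1, h2, -⟩ := (hB _ hvn).2 q hq
    exact ⟨h1, lt_of_lt_of_le (by positivity) h2⟩

theorem tendsto_charFun_mean (hQ : Q = quantile fun x => cdf μ x) (hγ : 0 < γ)
    (hℓ : SlowlyVaryingAtZero ℓ) (hQℓ : ∀ s ∈ Ioo (0 : ℝ) 1, Q (1 - s) = s ^ (-γ) * ℓ s)
    {κ : ℕ → ℕ} (hκ : Tendsto κ atTop atTop) {p : ℕ → ℝ} (hp : Tendsto p atTop atTop)
    {a : ℝ} (ha : 1 < a) (hap : ∀ᶠ n in atTop, a * p n ≤ Real.log (κ n))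
    {v : ℕ → ℝ} (hv : Tendsto v atTop (𝓝[>] 0)) (t : ℝ) :
    Tendsto (fun n => (κ n : ℂ) * (∫ u, Complex.exp ((t * (1 / (κ n * m Q γ (p n) (v n)) *
      Y Q γ (v n) u ^ p n) : ℝ) * Complex.I) ∂unif01 - 1)) atTop (𝓝 (t * Complex.I)) := by
  obtain ⟨r, ⟨hr1, hr2⟩, hlim⟩ := exists_tendsto_moment_ratio hQ hγ hℓ hQℓ hκ hp ha hap hv
  rw [tendsto_iff_norm_sub_tendsto_zero]
  have hlim' := hlim.const_mul (3 * |t| ^ r)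
  rw [mul_zero] at hlim'
  refine squeeze_zero' (Eventually.of_forall fun _ => norm_nonneg _) ?_ hlim'
  filter_upwards [eventually_moments hQ hγ hℓ hQℓ hv, hκ.eventually_gt_atTop 0,
    hp.eventually_gt_atTop 0] with n ⟨hY, hn⟩ hκn hpn
  have hpow : (fun u => (Y Q γ (v n) u ^ p n) ^ r) =ᵐ[unif01]
      fun u => Y Q γ (v n) u ^ (r * p n) := by
    filter_upwards [hY] with u hu
    rw [← Real.rpow_mul hu, mul_comm]
  have h := norm_charFun_mean_sub_le (ν := unif01) (Z := fun u => Y Q γ (v n) u ^ p n)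
    (by filter_upwards [hY] with u hu using Real.rpow_nonneg hu _) (hn _ hpn).1 hr1.le
    (by linarith) ((hn (r * p n) (by positivity)).1.congr hpow.symm) (hn _ hpn).2
    (K := κ n) (by exact_mod_cast hκn) t
  rw [integral_congr_ae hpow] at h
  exact_mod_cast h

theorem tendsto_charFun_standardized (hQ : Q = quantile fun x => cdf μ x) (hγ : 0 < γ)
    (hℓ : SlowlyVaryingAtZero ℓ) (hQℓ : ∀ s ∈ Ioo (0 : ℝ) 1, Q (1 - s) = s ^ (-γ) * ℓ s)
    {κ : ℕ → ℕ} (hκ : Tendsto κ atTop atTop) {p : ℕ → ℝ} (hp : Tendsto p atTop atTop)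
    {a : ℝ} (ha : 2 < a) (hap : ∀ᶠ n in atTop, a * p n ≤ Real.log (κ n))
    {v : ℕ → ℝ} (hv : Tendsto v atTop (𝓝[>] 0)) (t : ℝ) :
    Tendsto (fun n => (κ n : ℂ) * (∫ u, Complex.exp ((t * (1 / (√(κ n) * σ Q γ (p n) (v n)) *
      (Y Q γ (v n) u ^ p n - m Q γ (p n) (v n))) : ℝ) * Complex.I) ∂unif01 - 1)) atTop
      (𝓝 ((-(t ^ 2 / 2) : ℝ) : ℂ)) := by
  -- The second moment of `Y^p` is the moment of order `2p`, so the growth rate relative to `q = 2p`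
  -- is `a / 2 > 1`.
  obtain ⟨r, ⟨hr1, hr2⟩, hlim⟩ := exists_tendsto_moment_ratio hQ hγ hℓ hQℓ hκ
    (q := fun n => 2 * p n) (hp.const_mul_atTop (two_pos (α := ℝ))) (a := a / 2) (by linarith)
    (by filter_upwards [hap] with n hn; linarith) hv
  have hκ' : Tendsto (fun n => (κ n : ℝ) ^ (1 - r)) atTop (𝓝 0) := by
    have := (tendsto_rpow_neg_atTop (y := r - 1) (by linarith)).comp
      (tendsto_natCast_atTop_atTop.comp hκ)
    simpa [Function.comp_def] using this
  rw [tendsto_iff_norm_sub_tendsto_zero]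
  have hlim' := (hlim.add hκ').const_mul (4 * |t| ^ (2 * r) * 2 ^ r)
  rw [add_zero, mul_zero] at hlim'
  refine squeeze_zero' (Eventually.of_forall fun _ => norm_nonneg _) ?_ hlim'
  filter_upwards [eventually_moments hQ hγ hℓ hQℓ hv, hκ.eventually_gt_atTop 0,
    hp.eventually_gt_atTop 0, (tendsto_sq_mean_ratio hQ hγ hℓ hQℓ hp hv).eventually_le_const
      (show (0 : ℝ) < 1 / 2 by norm_num)] with n ⟨hY, hn⟩ hκn hpn hsmall
  have hpow : (fun u => (Y Q γ (v n) u ^ p n) ^ (2 * r)) =ᵐ[unif01]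
      fun u => Y Q γ (v n) u ^ (r * (2 * p n)) := by
    filter_upwards [hY] with u hu
    rw [← Real.rpow_mul hu]
    ring_nf
  have hpow2 : (fun u => (Y Q γ (v n) u ^ p n) ^ 2) =ᵐ[unif01]
      fun u => Y Q γ (v n) u ^ (2 * p n) := by
    filter_upwards [hY] with u hu
    rw [← Real.rpow_natCast, ← Real.rpow_mul hu, mul_comm]
    norm_num
  have hm2 : ∫ u, (Y Q γ (v n) u ^ p n) ^ 2 ∂unif01 = m Q γ (2 * p n) (v n) :=
    integral_congr_ae hpow2
  have hm2r : ∫ u, (Y Q γ (v n) u ^ p n) ^ (2 * r) ∂unif01 = m Q γ (r * (2 * p n)) (v n) :=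
    integral_congr_ae hpow
  have hpos2 := (hn (2 * p n) (by positivity)).2
  have h := norm_charFun_standardized_sub_le (ν := unif01) (Z := fun u => Y Q γ (v n) u ^ p n)
    (by filter_upwards [hY] with u hu using Real.rpow_nonneg hu _) (hn _ hpn).1
    ((hn (2 * p n) (by positivity)).1.congr hpow2.symm) hr1.le hr2.le
    ((hn (r * (2 * p n)) (by positivity)).1.congr hpow.symm) (by rw [hm2]; exact hpos2)
    (by
      rw [hm2]
      rw [div_le_iff₀ hpos2] at hsmall
      exact hsmall.trans (le_of_eq (by ring)))
    (K := κ n) (by exact_mod_cast hκn) t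
  rw [hm2, hm2r] at h
  exact_mod_cast h

end Asymptotics

/-! ### From deterministic levels to the random order statistic. -/

section OrderStatistics

variable {Ω : Type*} [MeasurableSpace Ω] {P : Measure Ω}
  {U : ℕ → Ω → ℝ}

lemma eventually_lt_of_div_tendsto_zero {k : ℕ → ℕ} {c : ℝ} (hc : 0 < c)
    (hkn : Tendsto (fun n : ℕ => (k n : ℝ) / (n : ℝ)) atTop (𝓝 0)) :
    ∀ᶠ n : ℕ in atTop, (k n : ℝ) < c * n := by
  filter_upwards [hkn.eventually_lt_const hc, eventually_gt_atTop 0] with n hn hn0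
  rwa [div_lt_iff₀ (by exact_mod_cast hn0)] at hn

/-- By the strong law the fraction of points below `c` tends to `c`, whereas `k / n → 0`; so
eventually more than `k` points lie below `c`. -/
theorem ae_tendsto_orderStat [IsProbabilityMeasure P]
    (hU : ∀ i, HasLaw (U i) unif01 P) (hindep : iIndepFun U P)
    {k : ℕ → ℕ} (hkn : Tendsto (fun n : ℕ => (k n : ℝ) / (n : ℝ)) atTop (𝓝 0)) :
    ∀ᵐ ω ∂P, Tendsto (fun n => orderStat (fun j => U j ω) n (k n + 1)) atTop (𝓝[>] 0) := by
  have hlaw : ∀ c ∈ Ioo (0 : ℝ) 1, ∀ᵐ ω ∂P,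
      ∀ᶠ n in atTop, orderStat (fun j => U j ω) n (k n + 1) ≤ c := by
    intro c hc
    set g : ℝ → ℝ := (Iic c).indicator fun _ => 1 with hg
    have hgm : Measurable g := measurable_const.indicator measurableSet_Iic
    have hint : Integrable (fun ω => g (U 0 ω)) P := by
      refine Integrable.of_bound (C := 1)
        (hgm.comp_aemeasurable (hU 0).aemeasurable).aestronglyMeasurable (ae_of_all _ fun ω => ?_)
      by_cases h : U 0 ω ∈ Iic c <;> simp [hg, h]
    have hmean : ∫ ω, g (U 0 ω) ∂P = c := by
      rw [← integral_map (hU 0).aemeasurable hgm.aestronglyMeasurable, (hU 0).map_eq,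
        integral_indicator measurableSet_Iic, unif01, Measure.restrict_restrict measurableSet_Iic,
        setIntegral_const]
      have : Iic c ∩ Ioo (0 : ℝ) 1 = Ioc 0 c := by
        ext x
        simp only [mem_inter_iff, mem_Iic, mem_Ioo, mem_Ioc]
        constructor
        · rintro ⟨h1, h2, -⟩; exact ⟨h2, h1⟩
        · rintro ⟨h1, h2⟩; exact ⟨h2, h1, h2.trans_lt hc.2⟩
      rw [this]
      simp [measureReal_def, hc.1.le]
    have hsl := strong_law_ae_real (fun i ω => g (U i ω)) hint
      (fun i j hij => (hindep.indepFun hij).comp hgm hgm)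
      (fun i => IdentDistrib.comp ⟨(hU i).aemeasurable, (hU 0).aemeasurable,
        by rw [(hU i).map_eq, (hU 0).map_eq]⟩ hgm)
    rw [hmean] at hsl
    filter_upwards [hsl] with ω hω
    filter_upwards [hω.eventually_const_le (show c / 2 < c by linarith [hc.1]),
      eventually_lt_of_div_tendsto_zero (half_pos hc.1) hkn,
      eventually_lt_of_div_tendsto_zero one_pos hkn, eventually_gt_atTop 0] with n h1 h2 h3 h4
    have hn0 : (0 : ℝ) < n := by exact_mod_cast h4
    have hkn' : k n < n := by rw [one_mul] at h3; exact_mod_cast h3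
    rw [orderStat_le_iff _ hkn', ← Nat.cast_lt (α := ℝ)]
    rw [le_div_iff₀ hn0] at h1
    refine (h2.trans_le h1).trans_le (le_of_eq ?_)
    rw [Finset.card_filter, Finset.sum_range]
    push_cast
    refine Finset.sum_congr rfl fun i _ => ?_
    simp [hg, Set.indicator_apply]
  have hall : ∀ᵐ ω ∂P, ∀ N : ℕ, ∀ᶠ n in atTop,
      orderStat (fun j => U j ω) n (k n + 1) ≤ 1 / ((N : ℝ) + 2) := by
    rw [ae_all_iff]
    intro N
    refine hlaw _ ⟨by positivity, ?_⟩
    rw [div_lt_one (by positivity)]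
    linarith [Nat.cast_nonneg (α := ℝ) N]
  filter_upwards [hall, ae_mem_Ioo hU] with ω h1 h2
  have hpos : ∀ᶠ n in atTop, 0 < orderStat (fun j => U j ω) n (k n + 1) := by
    filter_upwards [eventually_lt_of_div_tendsto_zero one_pos hkn] with n hn
    rw [one_mul] at hn
    obtain ⟨i, hi⟩ := orderStat_mem (fun j => U j ω) (n := n) (k := k n) (by exact_mod_cast hn)
    rw [hi]
    exact (h2 i).1
  refine tendsto_nhdsWithin_iff.2 ⟨tendsto_order.2 ⟨fun b hb => ?_, fun b hb => ?_⟩, hpos⟩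
  · filter_upwards [hpos] with n hn using hb.trans hn
  · obtain ⟨N, hN⟩ := exists_nat_one_div_lt hb
    filter_upwards [h1 N] with n hn
    refine (hn.trans ?_).trans_lt hN
    gcongr
    norm_num

lemma aemeasurable_orderStat (hU : ∀ i, HasLaw (U i) unif01 P) (n i : ℕ) :
    AEMeasurable (fun ω => orderStat (fun j => U j ω) n i) P :=
  (measurable_orderStat n i).comp_aemeasurable
    (aemeasurable_pi_lambda (fun ω j => U j ω) fun j => (hU j).aemeasurable)

lemma aemeasurable_sum_orderStat (hU : ∀ i, HasLaw (U i) unif01 P) {g : ℝ → ℝ → ℝ}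
    (hg : Measurable (Function.uncurry g)) (n k : ℕ) :
    AEMeasurable (fun ω => ∑ i ∈ Finset.Icc 1 k, g (orderStat (fun j => U j ω) n i)
      (orderStat (fun j => U j ω) n (k + 1))) P :=
  Finset.aemeasurable_fun_sum _ fun i _ => hg.comp_aemeasurable
    ((aemeasurable_orderStat hU n i).prodMk (aemeasurable_orderStat hU n (k + 1)))

/-- Limit of the characteristic functions of sums over the lower order statistics, from the
behaviour of a single summand given that the next order statistic is close to `0`. -/
theorem tendsto_charFun_sum_orderStat [IsProbabilityMeasure P]
    (hU : ∀ i, HasLaw (U i) unif01 P) (hindep : iIndepFun U P)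
    {k : ℕ → ℕ} (hk : Tendsto k atTop atTop)
    (hkn : Tendsto (fun n : ℕ => (k n : ℝ) / (n : ℝ)) atTop (𝓝 0))
    {g : ℕ → ℝ → ℝ → ℝ} (hg : ∀ n, Measurable (Function.uncurry (g n))) {t : ℝ} {c : ℂ}
    (hc : c.re ≤ 0)
    (hlim : ∀ v : ℕ → ℝ, Tendsto v atTop (𝓝[>] 0) →
      Tendsto (fun n => (k n : ℂ) * (∫ u, Complex.exp ((t * g n (u * v n) (v n) : ℝ) * Complex.I)
        ∂unif01 - 1)) atTop (𝓝 c)) :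
    Tendsto (fun n => charFun (P.map fun ω => ∑ i ∈ Finset.Icc 1 (k n),
      g n (orderStat (fun j => U j ω) n i) (orderStat (fun j => U j ω) n (k n + 1))) t) atTop
      (𝓝 (Complex.exp c)) := by
  set V : ℕ → Ω → ℝ := fun n ω => orderStat (fun j => U j ω) n (k n + 1) with hV
  set φ : ℕ → ℝ → ℂ := fun n v =>
    ∫ u, Complex.exp ((t * g n (u * v) v : ℝ) * Complex.I) ∂unif01 with hφ
  have hm : ∀ n, Measurable (Function.uncurry fun u v : ℝ =>
      Complex.exp ((t * g n u v : ℝ) * Complex.I)) := fun n => by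
    have := hg n
    simp only [Function.uncurry_def] at this ⊢
    fun_prop
  have hφm : ∀ n, Measurable (φ n) := fun n => by
    have : StronglyMeasurable fun q : ℝ × ℝ =>
        Complex.exp ((t * g n (q.2 * q.1) q.1 : ℝ) * Complex.I) :=
      ((hm n).comp (f := fun q : ℝ × ℝ => (q.2 * q.1, q.1)) (by fun_prop)).stronglyMeasurable
    exact this.integral_prod_right.measurable
  have hφb : ∀ n v, ‖φ n v‖ ≤ 1 := fun n v => by
    have := norm_integral_le_of_norm_le_const (μ := unif01) (C := 1)
      (ae_of_all _ fun u => (Complex.norm_exp_ofReal_mul_I (t * g n (u * v) v)).le)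
    simpa [hφ] using this
  -- Only for large `n`: the rank `k n + 1` must not exceed `n`, otherwise `orderStat` takes its
  -- default value.
  have hident : ∀ᶠ n in atTop, ∫ ω, φ n (V n ω) ^ k n ∂P =
      charFun (P.map fun ω => ∑ i ∈ Finset.Icc 1 (k n),
        g n (orderStat (fun j => U j ω) n i) (orderStat (fun j => U j ω) n (k n + 1))) t := by
    filter_upwards [eventually_lt_of_div_tendsto_zero one_pos hkn] with n hn
    rw [one_mul] at hn
    rw [charFun_apply_real, integral_map (aemeasurable_sum_orderStat hU (hg n) n (k n))
      (by fun_prop),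
      ← integral_prod_orderStat hU hindep (by exact_mod_cast hn) (hm n)
        fun u v => (Complex.norm_exp_ofReal_mul_I _).le]
    refine integral_congr_ae (ae_of_all _ fun ω => ?_)
    simp only
    rw [← Complex.exp_sum, ← Finset.sum_mul]
    congr 2
    push_cast
    rw [Finset.mul_sum]
  refine Tendsto.congr' hident ?_
  have hdct := tendsto_integral_of_dominated_convergence (μ := P)
    (F := fun n ω => φ n (V n ω) ^ k n) (f := fun _ => Complex.exp c) (fun _ => 1)
    (fun n => (((hφm n).pow_const _).comp_aemeasurable
      (aemeasurable_orderStat hU n (k n + 1))).aestronglyMeasurable)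
    (integrable_const _)
    (fun n => ae_of_all _ fun ω => by
      rw [norm_pow]
      exact pow_le_one₀ (norm_nonneg _) (hφb _ _))
    (by
      filter_upwards [ae_tendsto_orderStat hU hindep hkn] with ω hω
      exact tendsto_pow_exp hc hk (fun n => hφb _ _) (hlim _ hω))
  simpa using hdct

end OrderStatistics

/-! ### Measurability of the random normalisations. -/

section Measurability

variable {Q : ℝ → ℝ} {γ : ℝ}

lemma measurable_m (hQ : Measurable Q) (p : ℝ) : Measurable fun v => m Q γ p v := by
  have : StronglyMeasurable fun q : ℝ × ℝ => Y Q γ q.1 q.2 ^ p :=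
    ((measurable_Y hQ).pow_const p).stronglyMeasurable
  exact this.integral_prod_right.measurable

lemma measurable_σ (hQ : Measurable Q) (p : ℝ) : Measurable fun v => σ Q γ p v := by
  have h : Measurable fun q : ℝ × ℝ => ‖Y Q γ q.1 q.2 ^ p - m Q γ p q.1‖ₑ ^ 2 :=
    (((measurable_Y hQ).pow_const p).sub
      ((measurable_m hQ p).comp measurable_fst)).enorm.pow_const 2
  exact (h.lintegral_prod_right (ν := unif01)).ennreal_toReal.sqrt

end Measurability

/-- The limit is the characteristic function of the Dirac mass at `1`. The closed set of points at
distance at least `ε` from `1` is null for it, so its frontier is null and weak convergence passes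
to this set. -/
lemma tendstoInMeasure_one_of_tendsto_charFun {Ω : Type*} [MeasurableSpace Ω] {P : Measure Ω}
    [IsProbabilityMeasure P] {X : ℕ → Ω → ℝ} (hX : ∀ n, AEMeasurable (X n) P)
    (h : ∀ t : ℝ, Tendsto (fun n => charFun (P.map (X n)) t) atTop
      (𝓝 (Complex.exp (t * Complex.I)))) :
    TendstoInMeasure P X atTop fun _ => (1 : ℝ) := by
  let μs : ℕ → ProbabilityMeasure ℝ := fun n => ⟨P.map (X n), Measure.isProbabilityMeasure_map (hX n)⟩
  let μ₀ : ProbabilityMeasure ℝ := ⟨Measure.dirac 1, inferInstance⟩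
  have hlim : Tendsto μs atTop (𝓝 μ₀) := by
    refine ProbabilityMeasure.tendsto_iff_tendsto_charFun.2 fun t => ?_
    have : charFun (μ₀ : Measure ℝ) t = Complex.exp (t * Complex.I) := by
      simp [μ₀]
    rw [this]
    exact h t
  intro ε hε
  have hcl : IsClosed {x : ℝ | ε ≤ edist x 1} :=
    isClosed_le continuous_const (continuous_id.edist continuous_const)
  have hnull : (μ₀ : Measure ℝ) {x : ℝ | ε ≤ edist x 1} = 0 := by
    change Measure.dirac (1 : ℝ) _ = 0
    rw [Measure.dirac_apply' _ hcl.measurableSet]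
    simp [hε.ne']
  have := ProbabilityMeasure.tendsto_measure_of_null_frontier_of_tendsto' hlim
    (E := {x : ℝ | ε ≤ edist x 1}) (measure_mono_null hcl.frontier_subset hnull)
  rw [hnull] at this
  refine this.congr fun n => ?_
  change P.map (X n) _ = _
  rw [Measure.map_apply_of_aemeasurable (hX n) hcl.measurableSet]
  rfl

end ExtremalNorms

theorem mainTheorem4
    {Ω : Type*} [MeasurableSpace Ω] (P : Measure Ω) [IsProbabilityMeasure P]
    -- the iid uniform (0,1) variables
    (U : ℕ → Ω → ℝ) (hU : ∀ i, HasLaw (U i) ExtremalNorms.unif01 P) (hindep : iIndepFun U P)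
    -- the distribution with distribution function `cdf μ` and quantile function `Q`
    (μ : Measure ℝ) [IsProbabilityMeasure μ]
    (Q : ℝ → ℝ) (hQ : Q = ExtremalNorms.quantile (fun x => cdf μ x))
    (γ : ℝ) (hγ : 0 < γ)
    (ℓ : ℝ → ℝ) (hℓ : ExtremalNorms.SlowlyVaryingAtZero ℓ)
    (hQℓ : ∀ s ∈ Ioo (0 : ℝ) 1, Q (1 - s) = s ^ (-γ) * ℓ s)
    (k : ℕ → ℕ) (hk : Tendsto k atTop atTop)
    (hkn : Tendsto (fun n : ℕ => (k n : ℝ) / (n : ℝ)) atTop (𝓝 0))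
    (p : ℕ → ℝ) (hp : Tendsto p atTop atTop)
    (α : EReal)
    (hα : α = liminf (fun n : ℕ => ((Real.log (k n) / p n : ℝ) : EReal)) atTop)
    -- `V n i` is the order statistic `U_{i,n}`
    (V : ℕ → ℕ → Ω → ℝ)
    (hV : ∀ n i ω, V n i ω = ExtremalNorms.orderStat (fun j => U j ω) n i) :
    (1 < α →
      TendstoInMeasure P
        (fun (n : ℕ) (ω : Ω) =>
          1 / ((k n : ℝ) * ExtremalNorms.m Q γ (p n) (V n (k n + 1) ω)) *
            ∑ i ∈ Finset.Icc 1 (k n),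
              (Real.log (Q (1 - V n i ω) / Q (1 - V n (k n + 1) ω))) ^ (p n))
        atTop (fun _ => (1 : ℝ))) ∧
    (2 < α →
      TendstoInDistribution
        (fun (n : ℕ) (ω : Ω) =>
          1 / (Real.sqrt (k n) * ExtremalNorms.σ Q γ (p n) (V n (k n + 1) ω)) *
            ∑ i ∈ Finset.Icc 1 (k n),
              ((Real.log (Q (1 - V n i ω) / Q (1 - V n (k n + 1) ω))) ^ (p n)
                - ExtremalNorms.m Q γ (p n) (V n (k n + 1) ω)))
        atTop (id : ℝ → ℝ) (fun _ => P) (gaussianReal 0 1)) := by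
  have hQm : Measurable Q := hQ ▸ ExtremalNorms.measurable_quantile μ
  obtain rfl : V = fun n i ω => ExtremalNorms.orderStat (fun j => U j ω) n i := by
    ext n i ω
    exact hV n i ω
  -- A real `a` strictly between `b` and the liminf keeps a fixed margin, even when `α = ⊤`.
  have hgrow : ∀ b : ℝ, (b : EReal) < α →
      ∃ a, b < a ∧ ∀ᶠ n in atTop, a * p n ≤ Real.log (k n) := by
    intro b hb
    obtain ⟨a, hba, haα⟩ := EReal.lt_iff_exists_real_btwn.1 hb
    refine ⟨a, EReal.coe_lt_coe_iff.1 hba, ?_⟩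
    rw [hα] at haα
    filter_upwards [eventually_lt_of_lt_liminf haα, hp.eventually_gt_atTop 0] with n hn hpn
    exact ((lt_div_iff₀ hpn).1 (EReal.coe_lt_coe_iff.1 hn)).le
  have hY : ∀ v : ℕ → ℝ, Tendsto v atTop (𝓝[>] 0) → ∀ᶠ n in atTop, ∀ u,
      Real.log (Q (1 - u * v n) / Q (1 - v n)) = ExtremalNorms.Y Q γ (v n) u := by
    intro v hv
    filter_upwards [hv self_mem_nhdsWithin] with n hn u
    have : v n ≠ 0 := (show 0 < v n from hn).ne'
    simp [ExtremalNorms.Y, this]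
  refine ⟨fun h1 => ?_, fun h2 => ?_⟩
  · obtain ⟨a, ha, hak⟩ := hgrow 1 (by exact_mod_cast h1)
    -- Moving the random normalisation inside makes every summand a function of `U_{i,n}` and
    -- `U_{k+1,n}` alone.
    simp_rw [Finset.mul_sum]
    set g : ℕ → ℝ → ℝ → ℝ := fun n u v =>
      1 / ((k n : ℝ) * ExtremalNorms.m Q γ (p n) v) * Real.log (Q (1 - u) / Q (1 - v)) ^ p n
      with hg
    have hgm : ∀ n, Measurable (Function.uncurry (g n)) := fun n => by
      have := ExtremalNorms.measurable_m (γ := γ) hQm (p n)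
      simp only [hg, Function.uncurry_def]
      fun_prop
    refine ExtremalNorms.tendstoInMeasure_one_of_tendsto_charFun
      (fun n => ExtremalNorms.aemeasurable_sum_orderStat hU (hgm n) n (k n)) fun t => ?_
    refine ExtremalNorms.tendsto_charFun_sum_orderStat hU hindep hk hkn hgm (by simp)
      fun v hv => ?_
    refine (ExtremalNorms.tendsto_charFun_mean hQ hγ hℓ hQℓ hk hp ha hak hv t).congr' ?_
    filter_upwards [hY v hv] with n hn
    simp only [hg, hn]
  · obtain ⟨a, ha, hak⟩ := hgrow 2 (by exact_mod_cast h2)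
    simp_rw [Finset.mul_sum]
    set g : ℕ → ℝ → ℝ → ℝ := fun n u v =>
      1 / (√(k n) * ExtremalNorms.σ Q γ (p n) v) *
        (Real.log (Q (1 - u) / Q (1 - v)) ^ p n - ExtremalNorms.m Q γ (p n) v) with hg
    have hgm : ∀ n, Measurable (Function.uncurry (g n)) := fun n => by
      have := ExtremalNorms.measurable_m (γ := γ) hQm (p n)
      have := ExtremalNorms.measurable_σ (γ := γ) hQm (p n)
      simp only [hg, Function.uncurry_def]
      fun_prop
    have hmeas := fun n => ExtremalNorms.aemeasurable_sum_orderStat hU (hgm n) n (k n)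
    refine ⟨hmeas, aemeasurable_id, ProbabilityMeasure.tendsto_iff_tendsto_charFun.2 fun t => ?_⟩
    have hlim := ExtremalNorms.tendsto_charFun_sum_orderStat hU hindep hk hkn hgm (t := t)
      (c := ((-(t ^ 2 / 2) : ℝ) : ℂ)) (by rw [Complex.ofReal_re]; linarith [sq_nonneg t])
      fun v hv => by
        refine (ExtremalNorms.tendsto_charFun_standardized hQ hγ hℓ hQℓ hk hp ha hak hv t).congr' ?_
        filter_upwards [hY v hv] with n hn
        simp only [hg, hn]
    convert! hlim using 2
    simp [charFun_gaussianReal]
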